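/- **Problem.** Let $X\subseteq\mathbb R^d$ be closed, convex and bounded, let $f,g_1,\dots,g_m:\mathbb R^d\to\mathbb R$ be convex, and assume that some $x\in X$ satisfies $g_i(x)\le 0$ for all $i$. Let $f^*=\min\{f(x):x\in X,\ g_i(x)\le0,\ i=1,\dots,m\}$ and $\bar f=\min_X f$. A point $x\in X$ is $\varepsilon$-optimal if $f(x)-f^*\le\varepsilon$ and $\|[g(x)]_+\|_\infty\le\varepsilon$. An oracle returns values and fixed subgradients $f'(x),g_i'(x)$. Put $v(x,\eta)=\max\{f(x)-\eta,g_1(x),\dots,g_m(x)\}$ and $V(\eta)=\min_{x\in X}v(x,\eta)$, $\eta^*=\inf\{\eta:V(\eta)=0\}$ (so $\eta^*=f^*$), and let $v_\ell(x,z,\eta)$ be $v(x,\eta)$ with each of $f,g_i$ replaced by its linearization at $z$. **Gap reduction** $\mathcal G(x^0,l,\eta,\theta)$. Set $y^0=x^0$, $v_0^U=v(x^0,\eta)$, $v_0^L=l$, $\bar X_0=X$, $\lambda=\frac12(v_0^L+v_0^U)$. For $k=1,2,\dots$, with $\alpha_k=\frac2{k+1}$: let $z^k=(1-\alpha_k)y^{k-1}+\alpha_kx^{k-1}$,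 $h_k=\min_{x\in\bar X_{k-1}}v_\ell(x,z^k,\eta)$ and $v_k^L=\max\{v_{k-1}^L,\min\{\lambda,h_k\}\}$. If $v_k^L\ge\lambda-\theta(\lambda-v_0^L)$, return $(y^{k-1},v_k^L)$. Otherwise let $x^k$ minimize $\|x-x^0\|^2$ over $X_k^L=\{x\in\bar X_{k-1}:v_\ell(x,z^k,\eta)\le\lambda\}$, choose any closed convex $\bar X_k$ with $X_k^L\subseteq\bar X_k\subseteq\{x\in X:\langle x^k-x^0,x-x^k\rangle\ge0\}$, let $\tilde y^k=\alpha_kx^k+(1-\alpha_k)y^{k-1}$ and $v_k^U=\min\{v_{k-1}^U,v(\tilde y^k,\eta)\}$, and take any $y^k\in X$ with $v(y^k,\eta)=v_k^U$. If $v(\tilde y^k,\eta)-\lambda\le\theta(v_0^U-\lambda)$, return $(y^k,v_k^L)$. **APL method** $\mathcal A(x,l,\eta,\theta)$. While $v(x,\eta)-l>\frac{\alpha-1}\alpha v(x,\eta)$ and $v(x,\eta)>\varepsilon$, replace $(x,l)$ by the output of $\mathcal G(x,l,\eta,\theta)$. Return $(x,l)$. **Initialization.** Take any $w\in X$ with $f(w)-\bar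 f\le\varepsilon$ and set $\eta_0=f(w)$. Stop if $\max_ig_i(w)\le\varepsilon$. Otherwise compute $(x^0,l_0)=\mathcal A(w,\min_{x\in X}v_\ell(x,w,\eta_0),\eta_0,\frac12)$ and stop if $v(x^0,\eta_0)\le\varepsilon$. **Truncated inexact secant method.** If the initialization did not stop, set $u_0=v(x^0,\eta_0)$ and, for $t=1,2,\dots$ as long as $u_{t-1}>\varepsilon$, put $$\eta_1=\eta_0+\beta l_0,\qquad \eta_t=\eta_{t-1}+\beta\max\Big\{1,-\frac{\eta_{t-2}-\eta_{t-1}}{u_{t-2}-l_{t-1}}\Big\}l_{t-1}\quad(t\ge2),$$ $\tilde l_t=(1-\beta)l_{t-1}$, $(x^t,l_t)=\mathcal A(x^{t-1},\tilde l_t,\eta_t,2\nu-1)$, $u_t=v(x^t,\eta_t)$. When $u_T\le\varepsilon$, return $x^T$. **Theorem.** Let $\beta\in(1/2,1]$, $\alpha\in(1,2\sqrt\beta)$, $\nu\in(1/2,1)$, $\varepsilon>0$. In every execution that enters the while loop: 0. Every step of the method is well defined; $\{\eta_t\}$ is strictly increasing, and $\eta_t\le\eta^*$ for all $t$. 1.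 For all $t\ge1$, $\tilde l_t$ is a nonnegative lower bound of $V(\eta_t)$, and it is positive if $\beta<1$. 2. If the method stops at iteration $T$ (that is, $u_T\le\varepsilon$), then $\eta^*-\eta_T\le\varepsilon/(-V'(\eta^*))$ for every negative subgradient $V'(\eta^*)\in\partial V(\eta^*)$, and $x^T$ is $\varepsilon$-optimal. 3. Let $\rho\in[0,1]$ and suppose that for $h=f,g_1,\dots,g_m$ there are functions $M_h:\mathbb R^d\times\mathbb R^d\to(0,\infty)$, bounded by $\bar M$ on $X\times X$, with $h(y)-h(x)-\langle h'(x),y-x\rangle\le\frac{M_h(y,x)}{1+\rho}\|y-x\|^{1+\rho}$ for all $x,y$; let $\operatorname{diam}X\le D$ and $f^*-\bar f\le\Delta$. There is a constant $C$ depending only on $\alpha,\beta,\nu,\rho,\bar M,D,\Delta$ such that for every vector $y^*\in\mathbb R^m_+$ of Lagrange multipliers (the KKT conditions hold with $y^*$ at an optimal solution) and every $\varepsilon\in(0,\frac12]$, the number of oracle calls made in the while loop (evaluations, at a point, of the values, and subgradients if needed, of $f,g_1,\dots,g_m$) is at most $$C\,\min\Big\{(\|y^*\|_1+1)\big(\log(\|y^*\|_1+1)+1\big),\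 \log\tfrac1\varepsilon\Big\}\Big(\frac1\varepsilon\Big)^{\frac2{1+3\rho}}.$$ In particular the method terminates. -/

import Mathlib

open scoped RealInnerProductSpace

noncomputable section

namespace LevelSet

/-- Data of `min f(x)` subject to `x ∈ X`, `g i x ≤ 0` in `ℝ^d`, with a first-order oracle:
`df x`, `dg i x` are the subgradients returned at `x`. -/
structure Problem (d m : ℕ) where
  X : Set (EuclideanSpace ℝ (Fin d))
  f : EuclideanSpace ℝ (Fin d) → ℝ
  g : Fin m → EuclideanSpace ℝ (Fin d) → ℝ
  df : EuclideanSpace ℝ (Fin d) → EuclideanSpace ℝ (Fin d)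
  dg : Fin m → EuclideanSpace ℝ (Fin d) → EuclideanSpace ℝ (Fin d)

/-- `ξ` is a subgradient at `x` of the real-valued function `φ` on `ℝ^d`. -/
def IsSubgradient {d : ℕ} (φ : EuclideanSpace ℝ (Fin d) → ℝ)
    (x ξ : EuclideanSpace ℝ (Fin d)) : Prop :=
  ∀ y, φ x + ⟪ξ, y - x⟫ ≤ φ y

namespace Problem

variable {d m : ℕ}

/-- The feasible set. -/
def feasible (P : Problem d m) : Set (EuclideanSpace ℝ (Fin d)) :=
  {x | x ∈ P.X ∧ ∀ i, P.g i x ≤ 0}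

/-- Standing assumptions: `X` is a closed bounded convex set, the problem is feasible,
`f` and the `g i` are convex on `ℝ^d` and the oracle returns subgradients. -/
structure Admissible (P : Problem d m) : Prop where
  convex_X : Convex ℝ P.X
  closed_X : IsClosed P.X
  bounded_X : Bornology.IsBounded P.X
  feasible_nonempty : P.feasible.Nonempty
  convex_f : ConvexOn ℝ Set.univ P.f
  convex_g : ∀ i, ConvexOn ℝ Set.univ (P.g i)
  subgradient_f : ∀ x, IsSubgradient P.f x (P.df x)
  subgradient_g : ∀ i x, IsSubgradient (P.g i) x (P.dg i x)

/-- Hölder smoothness with exponent `ρ`: there are coefficient functions `M_0, ..., M_m`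
with positive values, bounded by `Mbar` on `X × X`, for which the Hölder upper bounds hold. -/
def HolderSmooth (P : Problem d m) (ρ Mbar : ℝ) : Prop :=
  ∃ (M₀ : EuclideanSpace ℝ (Fin d) → EuclideanSpace ℝ (Fin d) → ℝ)
    (M : Fin m → EuclideanSpace ℝ (Fin d) → EuclideanSpace ℝ (Fin d) → ℝ),
    (∀ y x, 0 < M₀ y x) ∧ (∀ i y x, 0 < M i y x) ∧
    (∀ y x, P.f y - P.f x - ⟪P.df x, y - x⟫ ≤ M₀ y x / (1 + ρ) * ‖y - x‖ ^ (1 + ρ)) ∧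
    (∀ i y x, P.g i y - P.g i x - ⟪P.dg i x, y - x⟫
      ≤ M i y x / (1 + ρ) * ‖y - x‖ ^ (1 + ρ)) ∧
    (∀ y ∈ P.X, ∀ x ∈ P.X, M₀ y x ≤ Mbar) ∧ (∀ i, ∀ y ∈ P.X, ∀ x ∈ P.X, M i y x ≤ Mbar)

/-- `v(x, η) = max {f(x) - η, g_1(x), ..., g_m(x)}`. -/
def v (P : Problem d m) (x : EuclideanSpace ℝ (Fin d)) (η : ℝ) : ℝ :=
  Finset.univ.sup' Finset.univ_nonempty
    (fun o : Option (Fin m) => o.elim (P.f x - η) (fun i => P.g i x))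

/-- The maximum of the linear minorants at `z`: `v_ℓ(x, z, η)`. -/
def vLin (P : Problem d m) (x z : EuclideanSpace ℝ (Fin d)) (η : ℝ) : ℝ :=
  Finset.univ.sup' Finset.univ_nonempty
    (fun o : Option (Fin m) => o.elim (P.f z + ⟪P.df z, x - z⟫ - η)
      (fun i => P.g i z + ⟪P.dg i z, x - z⟫))

/-- The value function `V(η) = min_{x ∈ X} v(x, η)`. -/
def V (P : Problem d m) (η : ℝ) : ℝ := sInf ((fun x => P.v x η) '' P.X)

/-- `η* = inf {η : V(η) = 0}`. -/
def etaStar (P : Problem d m) : ℝ := sInf {η | P.V η = 0}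

/-- The optimal value `f*`. -/
def fStar (P : Problem d m) : ℝ := sInf (P.f '' P.feasible)

/-- The unconstrained minimum `min_{x ∈ X} f(x)`. -/
def fBar (P : Problem d m) : ℝ := sInf (P.f '' P.X)

/-- `x` is `ε`-optimal: `x ∈ X`, `f(x) - f* ≤ ε` and `‖[g(x)]_+‖_∞ ≤ ε`
(the norm of `Fin m → ℝ` is the supremum norm). -/
def EpsOptimal (P : Problem d m) (ε : ℝ) (x : EuclideanSpace ℝ (Fin d)) : Prop :=
  x ∈ P.X ∧ P.f x - P.fStar ≤ ε ∧ ‖fun i : Fin m => max (P.g i x) 0‖ ≤ ε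

/-- `s` is a subgradient of the value function at `η`. -/
def IsSubgradientV (P : Problem d m) (η s : ℝ) : Prop :=
  ∀ η', P.V η + s * (η' - η) ≤ P.V η'

/-- `y` is a vector of Lagrange multipliers: the KKT conditions hold with `y` at some optimal
solution `x`. The vector `n` lies in the normal cone of `X` at `x`. -/
def IsMultiplier (P : Problem d m) (y : Fin m → ℝ) : Prop :=
  (∀ i, 0 ≤ y i) ∧
  ∃ x ∈ P.feasible, P.f x = P.fStar ∧ (∀ i, y i * P.g i x = 0) ∧
    ∃ (ξ₀ : EuclideanSpace ℝ (Fin d)) (ξ : Fin m → EuclideanSpace ℝ (Fin d))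
      (n : EuclideanSpace ℝ (Fin d)),
      IsSubgradient P.f x ξ₀ ∧ (∀ i, IsSubgradient (P.g i) x (ξ i)) ∧
      (∀ w ∈ P.X, 0 ≤ ⟪n, x - w⟫) ∧ ξ₀ + ∑ i, y i • ξ i + n = 0

end Problem

/-! ### Gap reduction -/

/-- State of the gap reduction after `k` completed iterations: start point `x0 = x^0`, initial
bounds `l0`, `u0`, the points `x = x^k`, `y = y^k`, the bounds `vL`, `vU` and the localizer
`Xbar` of iteration `k`. -/
structure GapState (d : ℕ) where
  x0 : EuclideanSpace ℝ (Fin d)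
  l0 : ℝ
  u0 : ℝ
  k : ℕ
  x : EuclideanSpace ℝ (Fin d)
  y : EuclideanSpace ℝ (Fin d)
  vL : ℝ
  vU : ℝ
  Xbar : Set (EuclideanSpace ℝ (Fin d))

namespace GapState

variable {d m : ℕ}

/-- The state in which the gap reduction starts from the point `x` and lower bound `l`. -/
def start (P : Problem d m) (η : ℝ) (x : EuclideanSpace ℝ (Fin d)) (l : ℝ) : GapState d :=
  { x0 := x, l0 := l, u0 := P.v x η, k := 0, x := x, y := x, vL := l, vU := P.v x η,
    Xbar := P.X }

/-- The guessed level `λ`. -/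
def level (q : GapState d) : ℝ := (q.l0 + q.u0) / 2

/-- The weight `α_{k+1} = 2 / (k + 2)` of the iteration that follows. -/
def weight (q : GapState d) : ℝ := 2 / ((q.k : ℝ) + 2)

/-- `z^{k+1} = (1 - α_{k+1}) y^k + α_{k+1} x^k`. -/
def z (q : GapState d) : EuclideanSpace ℝ (Fin d) :=
  (1 - q.weight) • q.y + q.weight • q.x

/-- `X^L_{k+1}`: the points of the current localizer at which the model is at most `λ`. -/
def lower (P : Problem d m) (η : ℝ) (q : GapState d) : Set (EuclideanSpace ℝ (Fin d)) :=
  {w | w ∈ q.Xbar ∧ P.vLin w q.z η ≤ q.level}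

/-- `X^U_{k+1}` for the new point `x'`. -/
def upper (P : Problem d m) (q : GapState d) (x' : EuclideanSpace ℝ (Fin d)) :
    Set (EuclideanSpace ℝ (Fin d)) :=
  {w | w ∈ P.X ∧ 0 ≤ ⟪x' - q.x0, w - x'⟫}

/-- `ỹ^{k+1} = α_{k+1} x' + (1 - α_{k+1}) y^k` for the new point `x'`. -/
def yTilde (q : GapState d) (x' : EuclideanSpace ℝ (Fin d)) : EuclideanSpace ℝ (Fin d) :=
  q.weight • x' + (1 - q.weight) • q.y

/-- `vL'` is the updated lower bound `max {vL, min {λ, h}}`, `h` being the minimum of the model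
over the current localizer. -/
def NewLower (P : Problem d m) (η : ℝ) (q : GapState d) (vL' : ℝ) : Prop :=
  ∃ h, IsLeast ((fun w => P.vLin w q.z η) '' q.Xbar) h ∧ vL' = max q.vL (min q.level h)

/-- The first termination test, on the updated lower bound. -/
def LowerTest (θ : ℝ) (q : GapState d) (vL' : ℝ) : Prop :=
  q.level - θ * (q.level - q.l0) ≤ vL'

/-- `x'` solves `min ‖x - x^0‖²` over the current localizer subject to the model being at most
`λ`. -/
def IsProx (P : Problem d m) (η : ℝ) (q : GapState d) (x' : EuclideanSpace ℝ (Fin d)) : Prop :=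
  x' ∈ q.lower P η ∧ ∀ w ∈ q.lower P η, ‖x' - q.x0‖ ^ 2 ≤ ‖w - q.x0‖ ^ 2

/-- The updated upper bound `min {vU, v(ỹ, η)}`. -/
def newUpper (P : Problem d m) (η : ℝ) (q : GapState d) (x' : EuclideanSpace ℝ (Fin d)) : ℝ :=
  min q.vU (P.v (q.yTilde x') η)

/-- `y'` is a point of `X` whose value is the updated upper bound. -/
def NewY (P : Problem d m) (η : ℝ) (q : GapState d) (x' y' : EuclideanSpace ℝ (Fin d)) : Prop :=
  y' ∈ P.X ∧ P.v y' η = q.newUpper P η x'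

/-- The second termination test, on `v(ỹ, η)`. -/
def UpperTest (P : Problem d m) (η θ : ℝ) (q : GapState d) (x' : EuclideanSpace ℝ (Fin d)) :
    Prop :=
  P.v (q.yTilde x') η - q.level ≤ θ * (q.u0 - q.level)

end GapState

/-! ### The accelerated prox-level (APL) method -/

/-- State of the APL method: the current pair `(x^s, l̄_s)`, and the state of the gap reduction
being executed (`none` at the head of the loop). -/
structure AplState (d : ℕ) where
  x : EuclideanSpace ℝ (Fin d)
  l : ℝ
  gap : Option (GapState d)

/-- The condition of the APL loop at `(x, l)`, with upper bound `u = v(x, η)`. -/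
def AplGuard {d m : ℕ} (P : Problem d m) (α ε η : ℝ) (x : EuclideanSpace ℝ (Fin d)) (l : ℝ) :
    Prop :=
  (α - 1) / α * P.v x η < P.v x η - l ∧ ε < P.v x η

/-- `AplStep P α ε η θ a n a'`: one step of the APL method from `a` to `a'`, making `n` oracle
calls. One oracle call returns, at one point, the values (and, where the model is built, the
subgradients) of `f, g_1, ..., g_m`. -/
inductive AplStep {d m : ℕ} (P : Problem d m) (α ε η θ : ℝ) :
    AplState d → ℕ → AplState d → Prop
  /-- Call the gap reduction, which evaluates `v` at its start point. -/
  | call (x : EuclideanSpace ℝ (Fin d)) (l : ℝ) :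
      AplGuard P α ε η x l →
      AplStep P α ε η θ ⟨x, l, none⟩ 1 ⟨x, l, some (GapState.start P η x l)⟩
  /-- A complete iteration of the gap reduction (no test is met): the model at `z` and the
  value at `ỹ`. -/
  | iterate (x : EuclideanSpace ℝ (Fin d)) (l : ℝ) (q : GapState d) (vL' : ℝ)
      (x' y' : EuclideanSpace ℝ (Fin d)) (Xbar' : Set (EuclideanSpace ℝ (Fin d))) :
      q.NewLower P η vL' → ¬ q.LowerTest θ vL' → q.IsProx P η x' →
      IsClosed Xbar' → Convex ℝ Xbar' → q.lower P η ⊆ Xbar' → Xbar' ⊆ q.upper P x' →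
      q.NewY P η x' y' → ¬ q.UpperTest P η θ x' →
      AplStep P α ε η θ ⟨x, l, some q⟩ 2
        ⟨x, l, some { q with k := q.k + 1, x := x', y := y', vL := vL',
                             vU := q.newUpper P η x', Xbar := Xbar' }⟩
  /-- The gap reduction stops at the first test; the APL method evaluates `v` at its output. -/
  | breakLower (x : EuclideanSpace ℝ (Fin d)) (l : ℝ) (q : GapState d) (vL' : ℝ) :
      q.NewLower P η vL' → q.LowerTest θ vL' →
      AplStep P α ε η θ ⟨x, l, some q⟩ 2 ⟨q.y, vL', none⟩
  /-- The gap reduction stops at the second test; the APL method evaluates `v` at its output. -/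
  | breakUpper (x : EuclideanSpace ℝ (Fin d)) (l : ℝ) (q : GapState d) (vL' : ℝ)
      (x' y' : EuclideanSpace ℝ (Fin d)) :
      q.NewLower P η vL' → ¬ q.LowerTest θ vL' → q.IsProx P η x' →
      q.NewY P η x' y' → q.UpperTest P η θ x' →
      AplStep P α ε η θ ⟨x, l, some q⟩ 3 ⟨y', vL', none⟩

/-- The APL method started from `(x, l)` can return `(x', l')`. -/
def AplReturns {d m : ℕ} (P : Problem d m) (α ε η θ : ℝ)
    (x : EuclideanSpace ℝ (Fin d)) (l : ℝ) (x' : EuclideanSpace ℝ (Fin d)) (l' : ℝ) : Prop :=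
  Relation.ReflTransGen (fun a a' => ∃ n, AplStep P α ε η θ a n a') ⟨x, l, none⟩ ⟨x', l', none⟩ ∧
  ¬ AplGuard P α ε η x' l'

/-- The initialization phase can return `(x, η₀, l₀)` with the flag `False` (root-finding
required). -/
def InitReturns {d m : ℕ} (P : Problem d m) (α ε : ℝ)
    (x : EuclideanSpace ℝ (Fin d)) (η₀ l₀ : ℝ) : Prop :=
  ∃ w ∈ P.X, P.f w - P.fBar ≤ ε ∧ η₀ = P.f w ∧ (∃ i, ε < P.g i w) ∧
    ∃ l, IsLeast ((fun x' => P.vLin x' w η₀) '' P.X) l ∧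
      AplReturns P α ε η₀ (1 / 2) w l x l₀ ∧ ε < P.v x η₀

/-! ### The APL-based truncated inexact secant method -/

/-- State of the while loop: the current index `t`, the computed sequences (entries beyond `t`
are irrelevant; those of `x`, `l`, `u` at `t` are set when the call of the APL method of
iteration `t` returns), the state of the call of the APL method being executed (`none` at the
head of the loop), and the number of oracle calls made so far in the loop. -/
structure SecantState (d : ℕ) where
  t : ℕ
  x : ℕ → EuclideanSpace ℝ (Fin d)
  η : ℕ → ℝ
  l : ℕ → ℝ
  u : ℕ → ℝ
  lTilde : ℕ → ℝ
  apl : Option (AplState d)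
  calls : ℕ

/-- The next level `η_{t+1}`: a fixed point step if `t = 0`, a truncated secant step if
`t ≥ 1`. -/
def SecantState.nextLevel {d : ℕ} (β : ℝ) (s : SecantState d) : ℝ :=
  if s.t = 0 then s.η s.t + β * s.l s.t
  else s.η s.t + β * max 1 (-((s.η (s.t - 1) - s.η s.t) / (s.u (s.t - 1) - s.l s.t))) * s.l s.t

/-- The method has left the while loop, and returns `x^t`. -/
def SecantState.Halted {d : ℕ} (ε : ℝ) (s : SecantState d) : Prop :=
  s.apl = none ∧ s.u s.t ≤ ε

/-- One step of the while loop. -/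
inductive SecantStep {d m : ℕ} (P : Problem d m) (α β ν ε : ℝ) :
    SecantState d → SecantState d → Prop
  /-- Begin iteration `t + 1`; `v(x^t, η_{t+1})` is evaluated here and again by the APL
  method. -/
  | enter (s : SecantState d) :
      s.apl = none → ε < s.u s.t →
      SecantStep P α β ν ε s
        { s with t := s.t + 1
                 η := Function.update s.η (s.t + 1) (s.nextLevel β)
                 lTilde := Function.update s.lTilde (s.t + 1) ((1 - β) * s.l s.t)
                 apl := some ⟨s.x s.t, (1 - β) * s.l s.t, none⟩
                 calls := s.calls + 2 }
  /-- A step of the APL method at level `η_t` with `θ = 2ν - 1`. -/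
  | inner (s : SecantState d) (a a' : AplState d) (n : ℕ) :
      s.apl = some a → AplStep P α ε (s.η s.t) (2 * ν - 1) a n a' →
      SecantStep P α β ν ε s { s with apl := some a', calls := s.calls + n }
  /-- The APL method returns `(x^t, l_t)`, and `u_t = v(x^t, η_t)` is evaluated. -/
  | finish (s : SecantState d) (w : EuclideanSpace ℝ (Fin d)) (lw : ℝ) :
      s.apl = some ⟨w, lw, none⟩ → ¬ AplGuard P α ε (s.η s.t) w lw →
      SecantStep P α β ν ε s
        { s with x := Function.update s.x s.t w
                 l := Function.update s.l s.t lw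
                 u := Function.update s.u s.t (P.v w (s.η s.t))
                 apl := none
                 calls := s.calls + 1 }

/-- The state in which the while loop starts, with the output `(x, η₀, l₀)` of the initialization
phase. -/
def SecantState.start {d m : ℕ} (P : Problem d m) (x : EuclideanSpace ℝ (Fin d)) (η₀ l₀ : ℝ) :
    SecantState d :=
  { t := 0, x := fun _ => x, η := fun _ => η₀, l := fun _ => l₀, u := fun _ => P.v x η₀,
    lTilde := fun _ => l₀, apl := none, calls := 0 }

/-- `s` is a state of the while loop in some execution of the method. -/
def Reachable {d m : ℕ} (P : Problem d m) (α β ν ε : ℝ) (s : SecantState d) : Prop :=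
  ∃ x η₀ l₀, InitReturns P α ε x η₀ l₀ ∧
    Relation.ReflTransGen (SecantStep P α β ν ε) (SecantState.start P x η₀ l₀) s

end LevelSet

end

/-! The value function `V` is convex, decreases at rate at most one, is positive exactly to the left
of `η* = f*` and vanishes there. Hence any level with a certified positive lower bound lies left of
`η*`. The secant step divides by `u_{t-1} - l_t`, which is at least the true drop `V(η_{t-1}) -
V(η_t)`, so it is no longer than the exact secant step, and by convexity that one does not pass `η*`
(`secantFactor_mul_V_le`). Extrapolating the same secant shows that the next step lowers `V` by at
most `β l_t`, so `(1 - β) l_t` is a valid initial bound (`le_V_next`).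

For the complexity put `p = 2 / (1 + 3ρ)`. A gap reduction started with gap `γ` takes `O(γ^{-p})`
iterations (`Rate.k_le`) and shrinks the gap by the factor `(1 + θ) / 2 = ν`. The APL guard keeps
`γ` above `(α - 1) / α * max ε (V η)`, so the costs within one call form a geometric sum of order
`max(ε, V(η))^{-p}` (`AplState.Cost.le`).

Across levels, let `σ_t` be the truncated factor of the secant step. The ratio `l_t / σ_t` contracts
by `q = α² / (4β) < 1` (`div_secantFactor_succ_le`). If `V(η) ≥ κ (η* - η)` at the levels left
behind, then `σ_t ≤ 1/κ`. At the last level left `α l ≥ ε`, so `i` levels earlier `V` is at least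
`(κ/α) q^{-i} ε`. The cost there is then of order `ε^{-p} min(1, (α/κ)^p q^{pi})`, and these sum to
`O((1 + log(1/κ)) ε^{-p})` (`sum_min_le`, `sum_budget_le`). The two terms of the minimum in the
bound come from two values of `κ`: `1 / (‖y*‖₁ + 1)`, by Lagrangian duality, and `ε / (αΔ)`, since
`V ≥ ε/α` at every level left behind. -/

namespace LevelSet

/-! ### The max-function `v` and its linear model. -/

namespace Problem

variable {d m : ℕ} {P : Problem d m}

lemma v_le_iff {x : EuclideanSpace ℝ (Fin d)} {η c : ℝ} :
    P.v x η ≤ c ↔ P.f x - η ≤ c ∧ ∀ i, P.g i x ≤ c := by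
  simp [v, Finset.sup'_le_iff, Option.forall]

lemma vLin_le_iff {x z : EuclideanSpace ℝ (Fin d)} {η c : ℝ} :
    P.vLin x z η ≤ c ↔ P.f z + ⟪P.df z, x - z⟫ - η ≤ c ∧
      ∀ i, P.g i z + ⟪P.dg i z, x - z⟫ ≤ c := by
  simp [vLin, Finset.sup'_le_iff, Option.forall]

lemma f_sub_le_v (P : Problem d m) (x : EuclideanSpace ℝ (Fin d)) (η : ℝ) :
    P.f x - η ≤ P.v x η :=
  (v_le_iff.1 le_rfl).1

lemma g_le_v (P : Problem d m) (x : EuclideanSpace ℝ (Fin d)) (η : ℝ) (i : Fin m) :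
    P.g i x ≤ P.v x η :=
  (v_le_iff.1 le_rfl).2 i

lemma v_antitone (P : Problem d m) (x : EuclideanSpace ℝ (Fin d)) : Antitone (P.v x) := by
  intro η η' h
  exact v_le_iff.2 ⟨by linarith [P.f_sub_le_v x η], P.g_le_v x η⟩

lemma v_le_add (P : Problem d m) (x : EuclideanSpace ℝ (Fin d)) {η η' : ℝ} (h : η ≤ η') :
    P.v x η ≤ P.v x η' + (η' - η) :=
  v_le_iff.2 ⟨by linarith [P.f_sub_le_v x η'], fun i => by linarith [P.g_le_v x η' i]⟩

namespace Admissible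

lemma v_combo (hP : P.Admissible) (x y : EuclideanSpace ℝ (Fin d)) (η η' : ℝ) {a b : ℝ}
    (ha : 0 ≤ a) (hb : 0 ≤ b) (hab : a + b = 1) :
    P.v (a • x + b • y) (a * η + b * η') ≤ a * P.v x η + b * P.v y η' := by
  refine v_le_iff.2 ⟨?_, fun i => ?_⟩
  · have h := hP.convex_f.2 (Set.mem_univ x) (Set.mem_univ y) ha hb hab
    simp only [smul_eq_mul] at h
    nlinarith [P.f_sub_le_v x η, P.f_sub_le_v y η']
  · have h := (hP.convex_g i).2 (Set.mem_univ x) (Set.mem_univ y) ha hb hab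
    simp only [smul_eq_mul] at h
    nlinarith [P.g_le_v x η i, P.g_le_v y η' i]

lemma vLin_le_v (hP : P.Admissible) (x z : EuclideanSpace ℝ (Fin d)) (η : ℝ) :
    P.vLin x z η ≤ P.v x η :=
  vLin_le_iff.2 ⟨by linarith [hP.subgradient_f z x, P.f_sub_le_v x η],
    fun i => (hP.subgradient_g i z x).trans (P.g_le_v x η i)⟩

lemma continuous_f (hP : P.Admissible) : Continuous P.f :=
  continuousOn_univ.1 (hP.convex_f.continuousOn isOpen_univ)

lemma continuous_g (hP : P.Admissible) (i : Fin m) : Continuous (P.g i) :=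
  continuousOn_univ.1 ((hP.convex_g i).continuousOn isOpen_univ)

lemma continuous_v (hP : P.Admissible) (η : ℝ) : Continuous fun x => P.v x η := by
  unfold v
  refine Continuous.finset_sup'_apply _ fun o _ => ?_
  cases o with
  | none => exact hP.continuous_f.sub continuous_const
  | some i => exact hP.continuous_g i

lemma isCompact_X (hP : P.Admissible) : IsCompact P.X :=
  Metric.isCompact_of_isClosed_isBounded hP.closed_X hP.bounded_X

lemma nonempty_X (hP : P.Admissible) : P.X.Nonempty :=
  hP.feasible_nonempty.mono fun _ h => h.1

end Admissible

lemma continuous_vLin (P : Problem d m) (z : EuclideanSpace ℝ (Fin d)) (η : ℝ) :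
    Continuous fun x => P.vLin x z η := by
  unfold vLin
  refine Continuous.finset_sup'_apply _ fun o _ => ?_
  cases o with
  | none => simp only [Option.elim]; fun_prop
  | some i => simp only [Option.elim]; fun_prop

lemma vLin_combo (P : Problem d m) (x y z : EuclideanSpace ℝ (Fin d)) (η : ℝ) {a b : ℝ}
    (ha : 0 ≤ a) (hb : 0 ≤ b) (hab : a + b = 1) :
    P.vLin (a • x + b • y) z η ≤ a * P.vLin x z η + b * P.vLin y z η := by
  have hx := (vLin_le_iff (P := P) (x := x) (z := z) (η := η)).1 le_rfl
  have hy := (vLin_le_iff (P := P) (x := y) (z := z) (η := η)).1 le_rfl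
  have e : a • x + b • y - z = a • (x - z) + b • (y - z) := by
    have : z = (a + b) • z := by rw [hab, one_smul]
    nth_rewrite 1 [this]
    module
  obtain rfl : b = 1 - a := by linarith
  refine vLin_le_iff.2 ⟨?_, fun i => ?_⟩
  · rw [e, inner_add_right, inner_smul_right, inner_smul_right]
    nlinarith [hx.1, hy.1]
  · rw [e, inner_add_right, inner_smul_right, inner_smul_right]
    nlinarith [hx.2 i, hy.2 i]

lemma convex_vLin_le (P : Problem d m) (z : EuclideanSpace ℝ (Fin d)) (η c : ℝ) :
    Convex ℝ {w | P.vLin w z η ≤ c} := by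
  intro x hx y hy a b ha hb hab
  have hx' : P.vLin x z η ≤ c := hx
  have hy' : P.vLin y z η ≤ c := hy
  refine (P.vLin_combo x y z η ha hb hab).trans ?_
  obtain rfl : b = 1 - a := by linarith
  nlinarith

/-! ### The value function `V`: convexity, root, error bound from multipliers. -/

namespace Admissible

lemma isLeast_V (hP : P.Admissible) (η : ℝ) :
    IsLeast ((fun x => P.v x η) '' P.X) (P.V η) :=
  (hP.isCompact_X.image (hP.continuous_v η)).isLeast_sInf (hP.nonempty_X.image _)

lemma exists_v_eq_V (hP : P.Admissible) (η : ℝ) : ∃ x ∈ P.X, P.v x η = P.V η :=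
  (hP.isLeast_V η).1

lemma V_le_v (hP : P.Admissible) {x : EuclideanSpace ℝ (Fin d)} (hx : x ∈ P.X) (η : ℝ) :
    P.V η ≤ P.v x η :=
  (hP.isLeast_V η).2 ⟨x, hx, rfl⟩

lemma V_le_add (hP : P.Admissible) {η η' : ℝ} (h : η ≤ η') : P.V η ≤ P.V η' + (η' - η) := by
  obtain ⟨x, hx, e⟩ := hP.exists_v_eq_V η'
  rw [← e]
  exact (hP.V_le_v hx η).trans (P.v_le_add x h)

lemma convexOn_V (hP : P.Admissible) : ConvexOn ℝ Set.univ P.V := by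
  refine ⟨convex_univ, fun η _ η' _ a b ha hb hab => ?_⟩
  obtain ⟨x, hx, e⟩ := hP.exists_v_eq_V η
  obtain ⟨y, hy, e'⟩ := hP.exists_v_eq_V η'
  simp only [smul_eq_mul]
  rw [← e, ← e']
  exact (hP.V_le_v (hP.convex_X hx hy ha hb hab) _).trans (hP.v_combo x y η η' ha hb hab)

lemma V_three_point (hP : P.Admissible) {a b c : ℝ} (hab : a ≤ b) (hbc : b ≤ c) :
    P.V b * (c - a) ≤ (c - b) * P.V a + (b - a) * P.V c := by
  rcases hab.eq_or_lt with rfl | hab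
  · linarith
  have hac : 0 < c - a := by linarith
  have h := hP.convexOn_V.2 (Set.mem_univ a) (Set.mem_univ c)
    (div_nonneg (sub_nonneg.2 hbc) hac.le) (div_nonneg (sub_nonneg.2 hab.le) hac.le)
    (by field_simp; ring)
  have e : ((c - b) / (c - a)) • a + ((b - a) / (c - a)) • c = b := by
    simp only [smul_eq_mul]; field_simp; ring
  rw [e] at h
  simp only [smul_eq_mul] at h
  calc P.V b * (c - a)
      ≤ ((c - b) / (c - a) * P.V a + (b - a) / (c - a) * P.V c) * (c - a) := by gcongr
    _ = _ := by field_simp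

lemma isLeast_fStar (hP : P.Admissible) : IsLeast (P.f '' P.feasible) P.fStar := by
  have hc : IsClosed P.feasible := by
    have : P.feasible = P.X ∩ ⋂ i, {x | P.g i x ≤ 0} := by
      ext x; simp [feasible]
    rw [this]
    exact hP.closed_X.inter (isClosed_iInter fun i =>
      isClosed_le (hP.continuous_g i) continuous_const)
  exact ((hP.isCompact_X.of_isClosed_subset hc fun _ h => h.1).image
    hP.continuous_f).isLeast_sInf (hP.feasible_nonempty.image _)

lemma V_nonpos_of_fStar_le (hP : P.Admissible) {η : ℝ} (h : P.fStar ≤ η) : P.V η ≤ 0 := by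
  obtain ⟨x, hx, e⟩ := hP.isLeast_fStar.1
  exact (hP.V_le_v hx.1 η).trans (v_le_iff.2 ⟨by linarith, hx.2⟩)

lemma V_pos_of_lt_fStar (hP : P.Admissible) {η : ℝ} (h : η < P.fStar) : 0 < P.V η := by
  obtain ⟨x, hx, e⟩ := hP.exists_v_eq_V η
  by_contra! hV
  rw [← e] at hV
  obtain ⟨h1, h2⟩ := v_le_iff.1 hV
  have := hP.isLeast_fStar.2 ⟨x, ⟨hx, h2⟩, rfl⟩
  linarith

lemma V_fStar (hP : P.Admissible) : P.V P.fStar = 0 := by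
  refine le_antisymm (hP.V_nonpos_of_fStar_le le_rfl) ?_
  obtain ⟨x, hx, e⟩ := hP.exists_v_eq_V P.fStar
  by_contra! hV
  rw [← e] at hV
  have h := P.f_sub_le_v x P.fStar
  have := hP.isLeast_fStar.2 ⟨x, ⟨hx, fun i => (P.g_le_v x P.fStar i).trans hV.le⟩, rfl⟩
  linarith

lemma etaStar_eq_fStar (hP : P.Admissible) : P.etaStar = P.fStar := by
  refine IsLeast.csInf_eq ⟨hP.V_fStar, fun η hη => ?_⟩
  by_contra! h
  exact (hP.V_pos_of_lt_fStar h).ne' hη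

lemma V_etaStar (hP : P.Admissible) : P.V P.etaStar = 0 := by
  rw [hP.etaStar_eq_fStar, hP.V_fStar]

lemma lt_etaStar_of_V_pos (hP : P.Admissible) {η : ℝ} (h : 0 < P.V η) : η < P.etaStar := by
  by_contra! h'
  rw [hP.etaStar_eq_fStar] at h'
  exact h.not_ge (hP.V_nonpos_of_fStar_le h')

lemma V_le_etaStar_sub (hP : P.Admissible) {η : ℝ} (h : η ≤ P.etaStar) :
    P.V η ≤ P.etaStar - η := by
  linarith [hP.V_le_add h, hP.V_etaStar]

/-- Secants of `V` to the left of `η₂` are at least as steep as the one from `η₂` to `η*`. -/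
lemma V_mul_sub_le (hP : P.Admissible) {η₁ η₂ : ℝ} (h : η₁ ≤ η₂) (h' : η₂ ≤ P.etaStar) :
    P.V η₂ * (η₂ - η₁) ≤ (P.V η₁ - P.V η₂) * (P.etaStar - η₂) := by
  have := hP.V_three_point h h'
  rw [hP.V_etaStar] at this
  linarith

lemma fBar_le (hP : P.Admissible) {x : EuclideanSpace ℝ (Fin d)} (hx : x ∈ P.X) :
    P.fBar ≤ P.f x :=
  csInf_le (hP.isCompact_X.image hP.continuous_f).bddBelow ⟨x, hx, rfl⟩

/-- Lagrange multipliers give an error bound for the value function. -/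
lemma etaStar_sub_le_of_isMultiplier (hP : P.Admissible) {y : Fin m → ℝ} (hy : P.IsMultiplier y)
    (η : ℝ) : P.etaStar - η ≤ (∑ i, |y i| + 1) * P.V η := by
  obtain ⟨hy0, x, hx, hfx, hcomp, ξ₀, ξ, n, hξ₀, hξ, hn, hsum⟩ := hy
  obtain ⟨w, hw, e⟩ := hP.exists_v_eq_V η
  -- Stationarity is paired with `w - x`, where `w` minimizes `v(·, η)` over `X`; subgradient
  -- inequalities and complementarity then give `f* ≤ f(w) + ∑ y_i g_i(w)`, whose terms are bounded
  -- through `V(η)`.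
  have h0 : ⟪ξ₀, w - x⟫ + ∑ i, y i * ⟪ξ i, w - x⟫ + ⟪n, w - x⟫ = 0 := by
    have := congrArg (fun t => ⟪t, w - x⟫) hsum
    simpa [inner_add_left, sum_inner, inner_smul_left] using this
  have h1 : 0 ≤ ⟪n, x - w⟫ := hn w hw
  have h1' : ⟪n, w - x⟫ = -⟪n, x - w⟫ := by rw [← inner_neg_right, neg_sub]
  have h2 := hξ₀ w
  have h3 : ∑ i, y i * ⟪ξ i, w - x⟫ ≤ ∑ i, |y i| * P.V η := by
    refine Finset.sum_le_sum fun i _ => ?_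
    rw [abs_of_nonneg (hy0 i)]
    have a := mul_le_mul_of_nonneg_left (hξ i w) (hy0 i)
    have b := mul_le_mul_of_nonneg_left (P.g_le_v w η i) (hy0 i)
    rw [e] at b
    linarith [hcomp i]
  rw [← Finset.sum_mul] at h3
  have h4 := P.f_sub_le_v w η
  rw [hP.etaStar_eq_fStar, ← hfx]
  linarith

end Admissible

/-- The Hölder bounds carry over to the model of the maximum. -/
lemma HolderSmooth.v_le_vLin_add {ρ Mbar : ℝ} (h : P.HolderSmooth ρ Mbar) (hρ : 0 ≤ ρ)
    {y z : EuclideanSpace ℝ (Fin d)} (hy : y ∈ P.X) (hz : z ∈ P.X) (η : ℝ) :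
    P.v y η ≤ P.vLin y z η + Mbar * ‖y - z‖ ^ (1 + ρ) := by
  obtain ⟨M₀, M, h0, h0', h1, h2, h3, h4⟩ := h
  have key : ∀ {c : ℝ}, 0 < c → c ≤ Mbar →
      c / (1 + ρ) * ‖y - z‖ ^ (1 + ρ) ≤ Mbar * ‖y - z‖ ^ (1 + ρ) := fun {c} hc hcM => by
    gcongr
    exact (div_le_self hc.le (by linarith)).trans hcM
  obtain ⟨e1, e2⟩ := (vLin_le_iff (P := P) (x := y) (z := z) (η := η)).1 le_rfl
  refine v_le_iff.2 ⟨?_, fun i => ?_⟩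
  · linarith [h1 y z, key (h0 y z) (h3 y hy z hz)]
  · linarith [h2 i y z, key (h0' i y z) (h4 i y hy z hz), e2 i]

lemma HolderSmooth.mono {ρ M M' : ℝ} (h : P.HolderSmooth ρ M) (hM : M ≤ M') :
    P.HolderSmooth ρ M' := by
  obtain ⟨M₀, M, h0, h0', h1, h2, h3, h4⟩ := h
  exact ⟨M₀, M, h0, h0', h1, h2, fun y hy x hx => (h3 y hy x hx).trans hM,
    fun i y hy x hx => (h4 i y hy x hx).trans hM⟩

end Problem

end LevelSet

/-! ### Gap reduction: invariants and well-definedness. -/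

namespace LevelSet

variable {d m : ℕ} {P : Problem d m} {η θ : ℝ}

namespace GapState

/-- The facts that hold throughout the gap reduction. -/
structure Valid (P : Problem d m) (η : ℝ) (q : GapState d) : Prop where
  x0_mem : q.x0 ∈ P.X
  l0_lt : q.l0 < q.u0
  l0_le : q.l0 ≤ q.vL
  vL_le : q.vL ≤ P.V η
  vU_le : q.vU ≤ q.u0
  y_mem : q.y ∈ P.X
  v_y : P.v q.y η = q.vU
  x_mem : q.x ∈ q.Xbar
  closed : IsClosed q.Xbar
  convex : Convex ℝ q.Xbar
  subset : q.Xbar ⊆ P.X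
  level_mem : ∀ w ∈ P.X, P.v w η ≤ q.level → w ∈ q.Xbar
  inner_nonneg : ∀ w ∈ q.Xbar, 0 ≤ ⟪q.x - q.x0, w - q.x⟫

lemma Valid.start (hP : P.Admissible) {x : EuclideanSpace ℝ (Fin d)} {l : ℝ} (hx : x ∈ P.X)
    (hl : l ≤ P.V η) (hlt : l < P.v x η) : (GapState.start P η x l).Valid P η where
  x0_mem := hx
  l0_lt := hlt
  l0_le := le_rfl
  vL_le := hl
  vU_le := le_rfl
  y_mem := hx
  v_y := rfl
  x_mem := hx
  closed := hP.closed_X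
  convex := hP.convex_X
  subset := subset_rfl
  level_mem := fun _ hw _ => hw
  inner_nonneg := fun w _ => by simp [GapState.start]

variable {q : GapState d}

lemma weight_pos (q : GapState d) : 0 < q.weight := by unfold weight; positivity

lemma weight_le_one (q : GapState d) : q.weight ≤ 1 := by
  unfold weight
  rw [div_le_one (by positivity)]
  linarith [Nat.cast_nonneg (α := ℝ) q.k]

namespace Valid

lemma lt_level (h : q.Valid P η) : q.l0 < q.level := by
  have := h.l0_lt; unfold level; linarith

lemma isCompact (hP : P.Admissible) (h : q.Valid P η) : IsCompact q.Xbar :=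
  hP.isCompact_X.of_isClosed_subset h.closed h.subset

lemma exists_newLower (hP : P.Admissible) (h : q.Valid P η) : ∃ vL', q.NewLower P η vL' :=
  ⟨_, _, ((h.isCompact hP).image (P.continuous_vLin q.z η)).isLeast_sInf
    (Set.Nonempty.image _ ⟨q.x, h.x_mem⟩), rfl⟩

/-- The cap at `λ` keeps the bound valid: if `V(η) < λ`, a minimizer of `v` survives in every
localizer; otherwise `λ` itself is a lower bound. -/
lemma newLower_le_V (hP : P.Admissible) (h : q.Valid P η) {vL' : ℝ} (hv : q.NewLower P η vL') :
    vL' ≤ P.V η := by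
  obtain ⟨c, hc, rfl⟩ := hv
  refine max_le h.vL_le ?_
  rcases le_or_gt q.level (P.V η) with hV | hV
  · exact (min_le_left _ _).trans hV
  · obtain ⟨w, hw, e⟩ := hP.exists_v_eq_V η
    refine (min_le_right _ _).trans ((hc.2 ⟨w, h.level_mem w hw (e.trans_lt hV).le, rfl⟩).trans ?_)
    exact (hP.vLin_le_v w q.z η).trans e.le

lemma l0_le_newLower (h : q.Valid P η) {vL' : ℝ} (hv : q.NewLower P η vL') : q.l0 ≤ vL' := by
  obtain ⟨c, hc, rfl⟩ := hv
  exact h.l0_le.trans (le_max_left _ _)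

lemma isClosed_lower (h : q.Valid P η) : IsClosed (q.lower P η) :=
  h.closed.inter (isClosed_le (P.continuous_vLin q.z η) continuous_const)

lemma convex_lower (h : q.Valid P η) : Convex ℝ (q.lower P η) :=
  h.convex.inter (P.convex_vLin_le q.z η q.level)

/-- If the model exceeded `λ` on the whole localizer, the updated lower bound would be at least `λ`
and the first test would succeed. -/
lemma lower_nonempty (h : q.Valid P η) (hθ : 0 ≤ θ) {vL' : ℝ} (hv : q.NewLower P η vL')
    (ht : ¬ q.LowerTest θ vL') : (q.lower P η).Nonempty := by
  obtain ⟨c, ⟨⟨w, hw, rfl⟩, hc⟩, rfl⟩ := hv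
  refine ⟨w, hw, ?_⟩
  by_contra! hlt
  refine ht ?_
  have hmin : min q.level (P.vLin w q.z η) = q.level := min_eq_left hlt.le
  unfold LowerTest
  have := h.lt_level
  refine le_trans ?_ (le_max_right _ _)
  rw [hmin]
  nlinarith

lemma exists_isProx (hP : P.Admissible) (h : q.Valid P η) (hn : (q.lower P η).Nonempty) :
    ∃ x', q.IsProx P η x' := by
  obtain ⟨x', hx', hmin⟩ := ((h.isCompact hP).of_isClosed_subset h.isClosed_lower
    fun _ hw => hw.1).exists_isMinOn hn
    (f := fun w => ‖w - q.x0‖ ^ 2) (by fun_prop)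
  exact ⟨x', hx', fun w hw => hmin hw⟩

/-- Obtuse-angle property of a projection onto a convex set. It makes the set `X^L` itself an
admissible next localizer, so an iteration can always be completed. -/
lemma lower_subset_upper (h : q.Valid P η) {x' : EuclideanSpace ℝ (Fin d)}
    (hx' : q.IsProx P η x') : q.lower P η ⊆ q.upper P x' := by
  intro w hw
  refine ⟨h.subset hw.1, ?_⟩
  by_contra! hneg
  have hne : 0 < ‖w - x'‖ ^ 2 := by
    have : w - x' ≠ 0 := fun e => by simp [e] at hneg
    positivity
  have key : ∀ t : ℝ, 0 < t → t ≤ 1 → 0 ≤ 2 * ⟪x' - q.x0, w - x'⟫ + t * ‖w - x'‖ ^ 2 := by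
    intro t ht ht1
    have hmem : (1 - t) • x' + t • w ∈ q.lower P η :=
      h.convex_lower hx'.1 hw (by linarith) ht.le (by ring)
    have h1 := hx'.2 _ hmem
    have e : (1 - t) • x' + t • w - q.x0 = (x' - q.x0) + t • (w - x') := by module
    rw [e, norm_add_sq_real, inner_smul_right, norm_smul, mul_pow, Real.norm_eq_abs, sq_abs] at h1
    have h2 : 0 ≤ t * (2 * ⟪x' - q.x0, w - x'⟫ + t * ‖w - x'‖ ^ 2) := by linarith
    exact nonneg_of_mul_nonneg_right h2 ht
  set a := ⟪x' - q.x0, w - x'⟫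
  set b := ‖w - x'‖ ^ 2
  -- For this step length `t b ≤ -a`, so `2a + t b ≤ a < 0`, against `key`.
  have h1 := key (min 1 (-a / b)) (lt_min one_pos (div_pos (by linarith) hne)) (min_le_left _ _)
  have h2 : min 1 (-a / b) * b ≤ -a := by
    calc _ ≤ -a / b * b := by gcongr; exact min_le_right _ _
      _ = -a := by field_simp
  linarith

lemma yTilde_mem (hP : P.Admissible) (h : q.Valid P η) {x' : EuclideanSpace ℝ (Fin d)}
    (hx' : q.IsProx P η x') : q.yTilde x' ∈ P.X :=
  hP.convex_X (h.subset hx'.1.1) h.y_mem q.weight_pos.le (by linarith [q.weight_le_one]) (by ring)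

lemma z_mem (hP : P.Admissible) (h : q.Valid P η) : q.z ∈ P.X :=
  hP.convex_X h.y_mem (h.subset h.x_mem) (by linarith [q.weight_le_one]) q.weight_pos.le (by ring)

lemma exists_newY (hP : P.Admissible) (h : q.Valid P η) {x' : EuclideanSpace ℝ (Fin d)}
    (hx' : q.IsProx P η x') : ∃ y', q.NewY P η x' y' := by
  unfold NewY newUpper
  rcases le_total q.vU (P.v (q.yTilde x') η) with hle | hle
  · exact ⟨q.y, h.y_mem, by rw [min_eq_left hle, h.v_y]⟩
  · exact ⟨_, h.yTilde_mem hP hx', by rw [min_eq_right hle]⟩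

lemma iterate (hP : P.Admissible) (h : q.Valid P η) {vL' : ℝ}
    {x' y' : EuclideanSpace ℝ (Fin d)} {Xbar' : Set (EuclideanSpace ℝ (Fin d))}
    (hv : q.NewLower P η vL') (hx' : q.IsProx P η x') (hc : IsClosed Xbar')
    (hconv : Convex ℝ Xbar') (hsub : q.lower P η ⊆ Xbar') (hsup : Xbar' ⊆ q.upper P x')
    (hy' : q.NewY P η x' y') :
    Valid P η { q with k := q.k + 1, x := x', y := y', vL := vL',
                       vU := q.newUpper P η x', Xbar := Xbar' } where
  x0_mem := h.x0_mem
  l0_lt := h.l0_lt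
  l0_le := h.l0_le_newLower hv
  vL_le := h.newLower_le_V hP hv
  vU_le := (min_le_left _ _).trans h.vU_le
  y_mem := hy'.1
  v_y := hy'.2
  x_mem := hsub hx'.1
  closed := hc
  convex := hconv
  subset := fun _ hw => (hsup hw).1
  level_mem := fun w hw hl => hsub ⟨h.level_mem w hw hl, (hP.vLin_le_v w q.z η).trans hl⟩
  inner_nonneg := fun _ hw => (hsup hw).2

/-- The gap after the first test stops the gap reduction. -/
lemma gap_breakLower (h : q.Valid P η) {vL' : ℝ} (ht : q.LowerTest θ vL') :
    P.v q.y η - vL' ≤ (1 + θ) / 2 * (q.u0 - q.l0) := by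
  have := h.vU_le
  rw [h.v_y]
  unfold LowerTest level at ht
  linarith

/-- The gap after the second test stops the gap reduction. -/
lemma gap_breakUpper (h : q.Valid P η) {vL' : ℝ} {x' y' : EuclideanSpace ℝ (Fin d)}
    (hv : q.NewLower P η vL') (hy' : q.NewY P η x' y') (ht : q.UpperTest P η θ x') :
    P.v y' η - vL' ≤ (1 + θ) / 2 * (q.u0 - q.l0) := by
  have h1 := h.l0_le_newLower hv
  have h2 : P.v y' η ≤ P.v (q.yTilde x') η := hy'.2.le.trans (min_le_right _ _)
  unfold UpperTest level at ht
  linarith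

end Valid

/-! ### Convergence rate of the gap reduction. -/

/-- Progress of the gap reduction after `k` iterations; the free parameter `N` is the scaling
in the weighted mean inequality, and is `k` in the end. -/
def Rate (M D ρ θ : ℝ) (q : GapState d) : Prop :=
  θ * (q.u0 - q.level) < q.vU - q.level ∧
  ∀ N : ℝ, 0 < N → (q.k : ℝ) * (q.k + 1) / 2 * (q.vU - q.level) ≤
    2 * M * (N ^ (3 * (1 - ρ) / 2) * D ^ (1 + ρ)) *
      ((1 - ρ) / 2 * ((q.k : ℝ) ^ 3 / N ^ 3) + (1 + ρ) / 2 * (‖q.x - q.x0‖ ^ 2 / D ^ 2))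

lemma Rate.start {x : EuclideanSpace ℝ (Fin d)} {l M D ρ : ℝ} (hlt : l < P.v x η) (hθ : θ < 1) :
    (GapState.start P η x l).Rate M D ρ θ := by
  refine ⟨?_, fun N hN => ?_⟩
  · simp only [GapState.start, level]; nlinarith
  · simp [GapState.start]

/-- Weighted AM-GM, applied termwise in place of Hölder's inequality for the sum over iterations.
The scales `N ^ 3` and `D ^ 2` match `∑_{j ≤ k} j² ≤ k³` and `∑ ‖x^j - x^{j-1}‖² ≤ D²`. -/
lemma rpow_mul_rpow_le {ρ N D j t : ℝ} (hρ : 0 ≤ ρ) (hρ' : ρ ≤ 1) (hN : 0 < N) (hD : 0 < D)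
    (hj : 0 ≤ j) (ht : 0 ≤ t) :
    j ^ (1 - ρ) * t ^ (1 + ρ) ≤ N ^ (3 * (1 - ρ) / 2) * D ^ (1 + ρ) *
      ((1 - ρ) / 2 * (j ^ 2 / N ^ 3) + (1 + ρ) / 2 * (t ^ 2 / D ^ 2)) := by
  have h := Real.geom_mean_le_arith_mean2_weighted (w₁ := (1 - ρ) / 2) (w₂ := (1 + ρ) / 2)
    (p₁ := j ^ 2 / N ^ 3) (p₂ := t ^ 2 / D ^ 2) (by linarith) (by linarith) (by positivity)
    (by positivity) (by ring)
  have e1 : (j ^ 2 / N ^ 3) ^ ((1 - ρ) / 2) = j ^ (1 - ρ) / N ^ (3 * (1 - ρ) / 2) := by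
    rw [Real.div_rpow (by positivity) (by positivity), ← Real.rpow_natCast j, ← Real.rpow_natCast N,
      ← Real.rpow_mul hj, ← Real.rpow_mul hN.le]
    congr 2 <;> push_cast <;> ring
  have e2 : (t ^ 2 / D ^ 2) ^ ((1 + ρ) / 2) = t ^ (1 + ρ) / D ^ (1 + ρ) := by
    rw [Real.div_rpow (by positivity) (by positivity), ← Real.rpow_natCast t, ← Real.rpow_natCast D,
      ← Real.rpow_mul ht, ← Real.rpow_mul hD.le]
    congr 2 <;> push_cast <;> ring
  rw [e1, e2] at h
  have hNp : 0 < N ^ (3 * (1 - ρ) / 2) := Real.rpow_pos_of_pos hN _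
  have hDp : 0 < D ^ (1 + ρ) := Real.rpow_pos_of_pos hD _
  calc j ^ (1 - ρ) * t ^ (1 + ρ)
      = N ^ (3 * (1 - ρ) / 2) * D ^ (1 + ρ) *
        (j ^ (1 - ρ) / N ^ (3 * (1 - ρ) / 2) * (t ^ (1 + ρ) / D ^ (1 + ρ))) := by field_simp
    _ ≤ _ := by gcongr

/-- Size of the smoothness error of iteration `j` after multiplication by `j (j + 1) / 2`, the
factor that makes the recursion telescope. -/
lemma weight_rpow_le {ρ j : ℝ} (hρ : 0 ≤ ρ) (hρ' : ρ ≤ 1) (hj : 0 < j) :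
    j * (j + 1) / 2 * (2 / (j + 1)) ^ (1 + ρ) ≤ 2 * j ^ (1 - ρ) := by
  have h1 : (2 / (j + 1)) ^ ρ ≤ 2 * j ^ (-ρ) := by
    calc (2 / (j + 1)) ^ ρ ≤ (2 / j) ^ ρ := by gcongr; linarith
      _ = 2 ^ ρ * j ^ (-ρ) := by
        rw [Real.div_rpow (by norm_num) hj.le, Real.rpow_neg hj.le, div_eq_mul_inv]
      _ ≤ 2 ^ (1 : ℝ) * j ^ (-ρ) := by gcongr; norm_num
      _ = _ := by rw [Real.rpow_one]
  rw [Real.rpow_add (by positivity), Real.rpow_one, sub_eq_add_neg, Real.rpow_add hj, Real.rpow_one]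
  calc j * (j + 1) / 2 * (2 / (j + 1) * (2 / (j + 1)) ^ ρ) = j * (2 / (j + 1)) ^ ρ := by
        field_simp
    _ ≤ j * (2 * j ^ (-ρ)) := by gcongr
    _ = _ := by ring

/-- One step of the accelerated scheme. -/
lemma Valid.v_yTilde_le (hP : P.Admissible) (h : q.Valid P η) {M ρ : ℝ}
    (hM : P.HolderSmooth ρ M) (hρ : 0 ≤ ρ) {x' : EuclideanSpace ℝ (Fin d)}
    (hx' : q.IsProx P η x') :
    P.v (q.yTilde x') η - q.level ≤ (1 - q.weight) * (q.vU - q.level) +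
      M * (q.weight ^ (1 + ρ) * ‖x' - q.x‖ ^ (1 + ρ)) := by
  have h1 := hM.v_le_vLin_add hρ (h.yTilde_mem hP hx') (h.z_mem hP) η
  have e : q.yTilde x' - q.z = q.weight • (x' - q.x) := by unfold yTilde z; module
  rw [e, norm_smul, Real.norm_of_nonneg q.weight_pos.le,
    Real.mul_rpow q.weight_pos.le (norm_nonneg _)] at h1
  have h2 := P.vLin_combo x' q.y q.z η q.weight_pos.le
    (by linarith [q.weight_le_one] : 0 ≤ 1 - q.weight) (by ring)
  have h3 : P.vLin q.y q.z η ≤ q.vU := (hP.vLin_le_v _ _ _).trans h.v_y.le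
  have h4 : P.vLin x' q.z η ≤ q.level := hx'.1.2
  have h5 := mul_le_mul_of_nonneg_left h4 q.weight_pos.le
  have h6 := mul_le_mul_of_nonneg_left h3 (by linarith [q.weight_le_one] : 0 ≤ 1 - q.weight)
  unfold yTilde at h1 ⊢
  linarith

/-- With `j = k + 1`, one has `j (j + 1) / 2 * (1 - 2 / (j + 1)) = (j - 1) j / 2`, so the scaled
gaps telescope. Each error term splits into a part in `j²`, absorbed by the growth of `k³`, and a
part in `‖x' - x‖²`, absorbed by the growth of `‖x - x0‖²`. -/
lemma Rate.iterate (hP : P.Admissible) (h : q.Valid P η) {M D ρ : ℝ}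
    (hM : P.HolderSmooth ρ M) (hM0 : 0 ≤ M) (hD : 0 < D) (hρ : 0 ≤ ρ) (hρ' : ρ ≤ 1)
    (hr : q.Rate M D ρ θ) {vL' : ℝ}
    {x' y' : EuclideanSpace ℝ (Fin d)} {Xbar' : Set (EuclideanSpace ℝ (Fin d))}
    (hx' : q.IsProx P η x') (ht : ¬ q.UpperTest P η θ x') :
    Rate M D ρ θ { q with k := q.k + 1, x := x', y := y', vL := vL',
                          vU := q.newUpper P η x', Xbar := Xbar' } := by
  refine ⟨?_, fun N hN => ?_⟩
  · change θ * (q.u0 - q.level) < min _ _ - q.level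
    unfold UpperTest at ht
    rcases min_choice q.vU (P.v (q.yTilde x') η) with e | e <;> rw [e]
    · exact hr.1
    · exact not_le.1 ht
  change ((q.k + 1 : ℕ) : ℝ) * ((q.k + 1 : ℕ) + 1) / 2 * (q.newUpper P η x' - q.level) ≤
    2 * M * (N ^ (3 * (1 - ρ) / 2) * D ^ (1 + ρ)) *
      ((1 - ρ) / 2 * (((q.k + 1 : ℕ) : ℝ) ^ 3 / N ^ 3) +
        (1 + ρ) / 2 * (‖x' - q.x0‖ ^ 2 / D ^ 2))
  have h0 := hr.2 N hN
  have h1 := h.v_yTilde_le hP hM hρ hx'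
  have h1' : q.newUpper P η x' ≤ P.v (q.yTilde x') η := min_le_right _ _
  -- The new point lies in the localizer, hence beyond the supporting hyperplane at the old one:
  -- squared distances add up.
  have h2 : ‖q.x - q.x0‖ ^ 2 + ‖x' - q.x‖ ^ 2 ≤ ‖x' - q.x0‖ ^ 2 := by
    have e : x' - q.x0 = (q.x - q.x0) + (x' - q.x) := by abel
    rw [e, norm_add_sq_real]
    linarith [h.inner_nonneg x' hx'.1.1]
  set k : ℝ := (q.k : ℝ) with hk
  have hk0 : 0 ≤ k := Nat.cast_nonneg _
  have hw : q.weight = 2 / (k + 1 + 1) := by unfold weight; rw [hk]; ring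
  push_cast
  rw [← hk]
  have h3 := weight_rpow_le hρ hρ' (by linarith : 0 < k + 1)
  have h4 := rpow_mul_rpow_le hρ hρ' hN hD (by linarith : 0 ≤ k + 1) (norm_nonneg (x' - q.x))
  set S := N ^ (3 * (1 - ρ) / 2) * D ^ (1 + ρ)
  have hS : 0 ≤ S := by positivity
  set t := ‖x' - q.x‖
  have ht0 : 0 ≤ t ^ (1 + ρ) := by positivity
  calc (k + 1) * (k + 1 + 1) / 2 * (q.newUpper P η x' - q.level)
      ≤ (k + 1) * (k + 1 + 1) / 2 * ((1 - q.weight) * (q.vU - q.level) +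
          M * (q.weight ^ (1 + ρ) * t ^ (1 + ρ))) := by gcongr; linarith
    _ = k * (k + 1) / 2 * (q.vU - q.level) +
          M * (((k + 1) * (k + 1 + 1) / 2 * (2 / (k + 1 + 1)) ^ (1 + ρ)) * t ^ (1 + ρ)) := by
        rw [hw]; field_simp; ring
    _ ≤ 2 * M * S * ((1 - ρ) / 2 * (k ^ 3 / N ^ 3) +
          (1 + ρ) / 2 * (‖q.x - q.x0‖ ^ 2 / D ^ 2)) +
        M * ((2 * (k + 1) ^ (1 - ρ)) * t ^ (1 + ρ)) := by gcongr
    _ = 2 * M * S * ((1 - ρ) / 2 * (k ^ 3 / N ^ 3) +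
          (1 + ρ) / 2 * (‖q.x - q.x0‖ ^ 2 / D ^ 2)) +
        2 * M * ((k + 1) ^ (1 - ρ) * t ^ (1 + ρ)) := by ring
    _ ≤ 2 * M * S * ((1 - ρ) / 2 * (k ^ 3 / N ^ 3) +
          (1 + ρ) / 2 * (‖q.x - q.x0‖ ^ 2 / D ^ 2)) +
        2 * M * (S * ((1 - ρ) / 2 * ((k + 1) ^ 2 / N ^ 3) + (1 + ρ) / 2 * (t ^ 2 / D ^ 2))) := by
        gcongr
    _ = 2 * M * S * ((1 - ρ) / 2 * ((k ^ 3 + (k + 1) ^ 2) / N ^ 3) +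
          (1 + ρ) / 2 * ((‖q.x - q.x0‖ ^ 2 + t ^ 2) / D ^ 2)) := by ring
    _ ≤ _ := by
        have : 0 ≤ 1 - ρ := by linarith
        -- What remains after monotonicity is `k³ + (k + 1)² ≤ (k + 1)³`.
        gcongr
        nlinarith

/-- The number of iterations of the gap reduction in terms of its initial gap. -/
lemma Rate.k_le (hP : P.Admissible) (h : q.Valid P η) {M D ρ : ℝ} (hM0 : 0 ≤ M) (hD : 0 < D)
    (hdiam : Metric.diam P.X ≤ D) (hρ : 0 ≤ ρ) (hθ : 0 < θ)
    (hr : q.Rate M D ρ θ) :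
    (q.k : ℝ) ≤ (8 * M * D ^ (1 + ρ) / θ) ^ (2 / (1 + 3 * ρ)) /
      (q.u0 - q.l0) ^ (2 / (1 + 3 * ρ)) := by
  have hγ : 0 < q.u0 - q.l0 := by linarith [h.l0_lt]
  have hDp : 0 < D ^ (1 + ρ) := by positivity
  rcases Nat.eq_zero_or_pos q.k with hk | hk
  · rw [hk, Nat.cast_zero]; positivity
  have hk0 : (0 : ℝ) < q.k := Nat.cast_pos.2 hk
  set k : ℝ := (q.k : ℝ) with hkdef
  -- The choice `N = k` turns the weighted mean into a quantity at most one.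
  have h1 := hr.2 k hk0
  rw [← hkdef] at h1
  have h2 : ‖q.x - q.x0‖ ≤ D := by
    rw [← dist_eq_norm]
    exact (Metric.dist_le_diam_of_mem hP.bounded_X (h.subset h.x_mem) h.x0_mem).trans hdiam
  have h3 : (1 - ρ) / 2 * (k ^ 3 / k ^ 3) + (1 + ρ) / 2 * (‖q.x - q.x0‖ ^ 2 / D ^ 2) ≤ 1 := by
    have : ‖q.x - q.x0‖ ^ 2 / D ^ 2 ≤ 1 := by
      rw [div_le_one (by positivity)]; gcongr
    rw [div_self (by positivity)]
    nlinarith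
  have h4 : k * (k + 1) / 2 * (q.vU - q.level) ≤
      2 * M * (k ^ (3 * (1 - ρ) / 2) * D ^ (1 + ρ)) :=
    h1.trans (mul_le_of_le_one_right (by positivity) h3)
  have h5 : θ * (q.u0 - q.l0) / 2 ≤ q.vU - q.level := by
    have := hr.1; unfold level at this ⊢; linarith
  have h6 : k ^ 2 * (θ * (q.u0 - q.l0)) ≤ k ^ (3 * (1 - ρ) / 2) * (8 * M * D ^ (1 + ρ)) := by
    have : k ^ 2 / 2 * (θ * (q.u0 - q.l0) / 2) ≤ k * (k + 1) / 2 * (q.vU - q.level) := by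
      gcongr
      nlinarith
    linarith
  have e : k ^ 2 = k ^ (3 * (1 - ρ) / 2) * k ^ ((1 + 3 * ρ) / 2) := by
    rw [← Real.rpow_add hk0, ← Real.rpow_natCast k 2]
    congr 1; push_cast; ring
  rw [e, mul_assoc] at h6
  have h7 := le_of_mul_le_mul_left h6 (Real.rpow_pos_of_pos hk0 _)
  have h8 : k ^ ((1 + 3 * ρ) / 2) ≤ 8 * M * D ^ (1 + ρ) / θ / (q.u0 - q.l0) := by
    rw [div_div, le_div_iff₀ (by positivity)]; exact h7
  rw [← Real.div_rpow (by positivity) hγ.le]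
  calc k = (k ^ ((1 + 3 * ρ) / 2)) ^ (2 / (1 + 3 * ρ)) := by
        rw [← Real.rpow_mul hk0.le, show (1 + 3 * ρ) / 2 * (2 / (1 + 3 * ρ)) = 1 by field_simp,
          Real.rpow_one]
    _ ≤ _ := by gcongr

end GapState

end LevelSet

/-! ### The APL method: validity and budget of one call. -/

namespace LevelSet

variable {d m : ℕ} {P : Problem d m} {α ε η θ : ℝ}

namespace AplState

/-- The lower bound is valid, and so is the state of the gap reduction. -/
def Valid (P : Problem d m) (η : ℝ) (a : AplState d) : Prop :=
  a.gap.elim (a.x ∈ P.X ∧ a.l ≤ P.V η) (fun q => q.Valid P η)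

lemma Valid.step (hP : P.Admissible) (hα : 1 < α) (hε : 0 < ε) {a a' : AplState d} {n : ℕ}
    (h : a.Valid P η) (hs : AplStep P α ε η θ a n a') : a'.Valid P η := by
  cases hs with
  | call x l hg =>
    have h' : x ∈ P.X ∧ l ≤ P.V η := h
    have : 0 < (α - 1) / α * P.v x η :=
      mul_pos (div_pos (by linarith) (by linarith)) (hε.trans hg.2)
    exact GapState.Valid.start hP h'.1 h'.2 (by linarith [hg.1])
  | iterate x l q vL' x' y' Xbar' hv _ hx' hc hconv hsub hsup hy' _ =>
    exact GapState.Valid.iterate hP (q := q) h hv hx' hc hconv hsub hsup hy'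
  | breakLower x l q vL' hv _ =>
    have h' : q.Valid P η := h
    exact ⟨h'.y_mem, h'.newLower_le_V hP hv⟩
  | breakUpper x l q vL' x' y' hv _ _ hy' _ =>
    have h' : q.Valid P η := h
    exact ⟨hy'.1, h'.newLower_le_V hP hv⟩

lemma Valid.reflTransGen (hP : P.Admissible) (hα : 1 < α) (hε : 0 < ε) {a a' : AplState d}
    (h : a.Valid P η)
    (hs : Relation.ReflTransGen (fun a a' => ∃ n, AplStep P α ε η θ a n a') a a') :
    a'.Valid P η := by
  induction hs with
  | refl => exact h
  | tail _ hst ih => obtain ⟨n, hst⟩ := hst; exact ih.step hP hα hε hst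

/-- The gap reduction can always continue. -/
lemma Valid.exists_step_some (hP : P.Admissible) (hθ : 0 ≤ θ) {x : EuclideanSpace ℝ (Fin d)}
    {l : ℝ} {q : GapState d} (h : q.Valid P η) :
    ∃ n a', AplStep P α ε η θ ⟨x, l, some q⟩ n a' := by
  obtain ⟨vL', hv⟩ := h.exists_newLower hP
  by_cases hl : q.LowerTest θ vL'
  · exact ⟨_, _, .breakLower x l q vL' hv hl⟩
  obtain ⟨x', hx'⟩ := h.exists_isProx hP (h.lower_nonempty hθ hv hl)
  obtain ⟨y', hy'⟩ := h.exists_newY hP hx'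
  by_cases hu : q.UpperTest P η θ x'
  · exact ⟨_, _, .breakUpper x l q vL' x' y' hv hl hx' hy' hu⟩
  · exact ⟨_, _, .iterate x l q vL' x' y' (q.lower P η) hv hl hx' h.isClosed_lower
      h.convex_lower subset_rfl (h.lower_subset_upper hx') hy' hu⟩

/-- The budget of the APL method at level `η`: `n` oracle calls have been made, and `B`, `U` are
a budget constant and a bound for the gaps. -/
def Cost (P : Problem d m) (α ε η θ M D ρ B U : ℝ) (n : ℕ) (a : AplState d) : Prop :=
  a.gap.elim
    (n * (P.v a.x η - a.l) ^ (2 / (1 + 3 * ρ)) ≤ B * ((1 + θ) / 2) ^ (2 / (1 + 3 * ρ)) ∧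
      n ≤ B / ((α - 1) / α * max ε (P.V η)) ^ (2 / (1 + 3 * ρ)) ∧ P.v a.x η - a.l ≤ U)
    (fun q => (n : ℝ) ≤ B * ((1 + θ) / 2) ^ (2 / (1 + 3 * ρ)) /
        (q.u0 - q.l0) ^ (2 / (1 + 3 * ρ)) + 1 + 2 * q.k ∧
      (α - 1) / α * max ε (P.V η) < q.u0 - q.l0 ∧ q.u0 - q.l0 ≤ U ∧ q.Rate M D ρ θ)

variable {M D ρ B U : ℝ}

lemma Cost.start {x : EuclideanSpace ℝ (Fin d)} {l : ℝ} (hα : 1 < α) (hε : 0 < ε) (hB : 0 ≤ B)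
    (hθ : 0 ≤ θ) (hU : P.v x η - l ≤ U) : Cost P α ε η θ M D ρ B U 0 ⟨x, l, none⟩ := by
  have : 0 < (α - 1) / α := div_pos (by linarith) (by linarith)
  have : 0 < max ε (P.V η) := lt_max_of_lt_left hε
  refine ⟨?_, ?_, hU⟩
  · rw [Nat.cast_zero, zero_mul]; positivity
  · rw [Nat.cast_zero]; positivity

/-- The condition `hB` makes `B` reproduce itself over one gap reduction. Earlier calls take the
share `B ((1 + θ) / 2)^p`, the iterations take the last summand, and the `4` pays for one call on
entry and at most three on exit, since `γ ≤ U` gives `1 ≤ U^p / γ^p`. -/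
lemma Cost.le_of_some (hP : P.Admissible) (hM0 : 0 ≤ M) (hD : 0 < D)
    (hdiam : Metric.diam P.X ≤ D) (hρ : 0 ≤ ρ) (hθ : 0 < θ)
    (hB : B * ((1 + θ) / 2) ^ (2 / (1 + 3 * ρ)) + 4 * U ^ (2 / (1 + 3 * ρ)) +
      2 * (8 * M * D ^ (1 + ρ) / θ) ^ (2 / (1 + 3 * ρ)) ≤ B)
    {n : ℕ} {x : EuclideanSpace ℝ (Fin d)} {l : ℝ} {q : GapState d} (hv : q.Valid P η)
    (h : Cost P α ε η θ M D ρ B U n ⟨x, l, some q⟩) :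
    (n : ℝ) + 3 ≤ B / (q.u0 - q.l0) ^ (2 / (1 + 3 * ρ)) := by
  obtain ⟨h1, h2, h3, h4⟩ : (n : ℝ) ≤ B * ((1 + θ) / 2) ^ (2 / (1 + 3 * ρ)) /
        (q.u0 - q.l0) ^ (2 / (1 + 3 * ρ)) + 1 + 2 * q.k ∧
      (α - 1) / α * max ε (P.V η) < q.u0 - q.l0 ∧ q.u0 - q.l0 ≤ U ∧ q.Rate M D ρ θ := h
  have hk := h4.k_le hP hv hM0 hD hdiam hρ hθ
  have hγ : 0 < q.u0 - q.l0 := by linarith [hv.l0_lt]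
  set p := 2 / (1 + 3 * ρ)
  have hp : 0 ≤ p := by positivity
  have hγp : 0 < (q.u0 - q.l0) ^ p := by positivity
  have h5 : 1 ≤ U ^ p / (q.u0 - q.l0) ^ p := by
    rw [one_le_div hγp]; gcongr
  calc (n : ℝ) + 3 ≤ B * ((1 + θ) / 2) ^ p / (q.u0 - q.l0) ^ p +
        4 * (U ^ p / (q.u0 - q.l0) ^ p) +
        2 * ((8 * M * D ^ (1 + ρ) / θ) ^ p / (q.u0 - q.l0) ^ p) := by linarith
    _ = (B * ((1 + θ) / 2) ^ p + 4 * U ^ p + 2 * (8 * M * D ^ (1 + ρ) / θ) ^ p) /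
        (q.u0 - q.l0) ^ p := by ring
    _ ≤ _ := by gcongr

/-- As the gap has shrunk by `(1 + θ) / 2`, the bound `B / γ^p` becomes the smaller share required
at the head of the loop. There the invariant is a product, so that a zero gap is harmless. -/
lemma cost_none (hP : P.Admissible) (hα : 1 < α) (hε : 0 < ε) (hB0 : 0 ≤ B) (hρ : 0 ≤ ρ)
    (hθ : 0 ≤ θ) (hθ' : θ ≤ 1) {n : ℕ} {x : EuclideanSpace ℝ (Fin d)} {l γ : ℝ} (hx : x ∈ P.X)
    (hl : l ≤ P.V η) (hγ : 0 < γ) (hγU : γ ≤ U) (hm : (α - 1) / α * max ε (P.V η) < γ)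
    (hgap : P.v x η - l ≤ (1 + θ) / 2 * γ) (hn : (n : ℝ) ≤ B / γ ^ (2 / (1 + 3 * ρ))) :
    Cost P α ε η θ M D ρ B U n ⟨x, l, none⟩ := by
  have hV := hP.V_le_v hx η
  have hc : 0 < (α - 1) / α := div_pos (by linarith) (by linarith)
  have hmx : 0 < max ε (P.V η) := lt_max_of_lt_left hε
  set p := 2 / (1 + 3 * ρ)
  have hp : 0 ≤ p := by positivity
  have hγp : 0 < γ ^ p := by positivity
  refine ⟨?_, hn.trans ?_, ?_⟩
  · calc (n : ℝ) * (P.v x η - l) ^ p ≤ B / γ ^ p * ((1 + θ) / 2 * γ) ^ p := by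
          have : 0 ≤ P.v x η - l := by linarith
          gcongr
      _ = _ := by
          rw [Real.mul_rpow (by linarith) hγ.le]; field_simp; rfl
  · gcongr
  · change P.v x η - l ≤ U
    nlinarith

lemma Cost.step (hP : P.Admissible) (hM : P.HolderSmooth ρ M) (hM0 : 0 ≤ M) (hD : 0 < D)
    (hdiam : Metric.diam P.X ≤ D) (hρ : 0 ≤ ρ) (hρ' : ρ ≤ 1) (hθ : 0 < θ) (hθ' : θ < 1)
    (hα : 1 < α) (hε : 0 < ε) (hB0 : 0 ≤ B)
    (hB : B * ((1 + θ) / 2) ^ (2 / (1 + 3 * ρ)) + 4 * U ^ (2 / (1 + 3 * ρ)) +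
      2 * (8 * M * D ^ (1 + ρ) / θ) ^ (2 / (1 + 3 * ρ)) ≤ B)
    {a a' : AplState d} {n n' : ℕ} (hv : a.Valid P η) (h : Cost P α ε η θ M D ρ B U n a)
    (hs : AplStep P α ε η θ a n' a') : Cost P α ε η θ M D ρ B U (n + n') a' := by
  have hc : 0 < (α - 1) / α := div_pos (by linarith) (by linarith)
  cases hs with
  | call x l hg =>
    obtain ⟨h1, h2, h3⟩ : n * (P.v x η - l) ^ (2 / (1 + 3 * ρ)) ≤
      B * ((1 + θ) / 2) ^ (2 / (1 + 3 * ρ)) ∧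
      n ≤ B / ((α - 1) / α * max ε (P.V η)) ^ (2 / (1 + 3 * ρ)) ∧ P.v x η - l ≤ U := h
    have hv' : x ∈ P.X ∧ l ≤ P.V η := hv
    have h4 : (α - 1) / α * max ε (P.V η) < P.v x η - l := by
      refine lt_of_le_of_lt ?_ hg.1
      gcongr
      exact max_le hg.2.le (hP.V_le_v hv'.1 η)
    have h5 : 0 < P.v x η - l := lt_trans (mul_pos hc (lt_max_of_lt_left hε)) h4
    refine ⟨?_, h4, h3, GapState.Rate.start (by linarith) hθ'⟩
    rw [← le_div_iff₀ (by positivity)] at h1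
    simp only [GapState.start]
    push_cast
    linarith
  | iterate x l q vL' x' y' Xbar' hv' _ hx' hc hconv hsub hsup hy' hu =>
    obtain ⟨h1, h2, h3, h4⟩ := h
    refine ⟨?_, h2, h3, GapState.Rate.iterate hP hv hM hM0 hD hρ hρ' h4 hx' hu⟩
    simp only
    push_cast
    linarith
  | breakLower x l q vL' hv' hl =>
    have hq : q.Valid P η := hv
    have h1 := h.le_of_some hP hM0 hD hdiam hρ hθ hB hq
    obtain ⟨-, h2, h3, -⟩ := h
    refine cost_none hP hα hε hB0 hρ hθ.le hθ'.le hq.y_mem (hq.newLower_le_V hP hv')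
      (by linarith [hq.l0_lt]) h3 h2 (hq.gap_breakLower hl) ?_
    push_cast; linarith
  | breakUpper x l q vL' x' y' hv' _ _ hy' hu =>
    have hq : q.Valid P η := hv
    have h1 := h.le_of_some hP hM0 hD hdiam hρ hθ hB hq
    obtain ⟨-, h2, h3, -⟩ := h
    refine cost_none hP hα hε hB0 hρ hθ.le hθ'.le hy'.1 (hq.newLower_le_V hP hv')
      (by linarith [hq.l0_lt]) h3 h2 (hq.gap_breakUpper hv' hy' hu) ?_
    push_cast; linarith

/-- The budget bounds the number of oracle calls of one run of the APL method. -/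
lemma Cost.le (hP : P.Admissible) (hM0 : 0 ≤ M) (hD : 0 < D)
    (hdiam : Metric.diam P.X ≤ D) (hρ : 0 ≤ ρ) (hθ : 0 < θ) (hα : 1 < α) (hε : 0 < ε)
    (hB0 : 0 ≤ B)
    (hB : B * ((1 + θ) / 2) ^ (2 / (1 + 3 * ρ)) + 4 * U ^ (2 / (1 + 3 * ρ)) +
      2 * (8 * M * D ^ (1 + ρ) / θ) ^ (2 / (1 + 3 * ρ)) ≤ B)
    {n : ℕ} {a : AplState d} (hv : a.Valid P η) (h : Cost P α ε η θ M D ρ B U n a) :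
    (n : ℝ) ≤ B / ((α - 1) / α * max ε (P.V η)) ^ (2 / (1 + 3 * ρ)) := by
  obtain ⟨x, l, _ | q⟩ := a
  · exact h.2.1
  · have h1 := h.le_of_some hP hM0 hD hdiam hρ hθ hB hv
    have hc : 0 < (α - 1) / α := div_pos (by linarith) (by linarith)
    have hmx : 0 < max ε (P.V η) := lt_max_of_lt_left hε
    refine (by linarith : (n : ℝ) ≤ _).trans (h1.trans ?_)
    have h2 : (α - 1) / α * max ε (P.V η) ≤ q.u0 - q.l0 := h.2.1.le
    gcongr

end AplState

/-- What the exit test of the APL method guarantees for its lower bound. -/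
lemma le_mul_of_not_aplGuard (hα : 1 < α) {x : EuclideanSpace ℝ (Fin d)} {l : ℝ}
    (h : ¬ AplGuard P α ε η x l) (hv : ε < P.v x η) : P.v x η ≤ α * l := by
  unfold AplGuard at h
  have h1 : P.v x η - l ≤ (α - 1) / α * P.v x η := by
    by_contra! h'
    exact h ⟨h', hv⟩
  have h2 : (α - 1) / α * P.v x η = P.v x η - P.v x η / α := by
    field_simp
  rw [h2] at h1
  have h3 : P.v x η / α ≤ l := by linarith
  rwa [div_le_iff₀' (by linarith)] at h3

lemma InitReturns.valid (hP : P.Admissible) (hα : 1 < α) (hε : 0 < ε)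
    {x : EuclideanSpace ℝ (Fin d)} {η₀ l₀ : ℝ} (h : InitReturns P α ε x η₀ l₀) :
    x ∈ P.X ∧ l₀ ≤ P.V η₀ ∧ ¬ AplGuard P α ε η₀ x l₀ ∧ ε < P.v x η₀ ∧ P.fBar ≤ η₀ := by
  obtain ⟨w, hw, -, rfl, -, l, hl, ⟨hr, hg⟩, hε'⟩ := h
  have hv : AplState.Valid P (P.f w) (⟨w, l, none⟩ : AplState d) := by
    refine ⟨hw, ?_⟩
    obtain ⟨z, hz, e⟩ := hP.exists_v_eq_V (P.f w)
    exact (hl.2 ⟨z, hz, rfl⟩).trans ((hP.vLin_le_v z w _).trans e.le)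
  obtain ⟨h1, h2⟩ := hv.reflTransGen hP hα hε hr
  exact ⟨h1, h2, hg, hε', hP.fBar_le hw⟩

end LevelSet

/-! ### Analysis of the truncated secant iteration. -/

namespace LevelSet

/-- The truncated factor of the secant step. -/
noncomputable def secantFactor (η l u : ℕ → ℝ) (t : ℕ) : ℝ :=
  if t = 0 then 1 else max 1 (-((η (t - 1) - η t) / (u (t - 1) - l t)))

lemma one_le_secantFactor (η l u : ℕ → ℝ) (t : ℕ) : 1 ≤ secantFactor η l u t := by
  unfold secantFactor
  split_ifs
  · exact le_rfl
  · exact le_max_left _ _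

lemma secantFactor_succ (η l u : ℕ → ℝ) (t : ℕ) :
    secantFactor η l u (t + 1) = max 1 ((η (t + 1) - η t) / (u t - l (t + 1))) := by
  simp only [secantFactor, Nat.add_one_ne_zero, if_false, Nat.add_sub_cancel]
  rw [← neg_div, neg_sub]

/-- The sequences produced by `T` secant steps. -/
structure SecantTrace {d m : ℕ} (P : Problem d m) (α β ε : ℝ) (η l u : ℕ → ℝ) (T : ℕ) :
    Prop where
  l_le : ∀ t < T, l t ≤ P.V (η t)
  V_le : ∀ t < T, P.V (η t) ≤ u t
  u_le : ∀ t < T, u t ≤ α * l t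
  eps_lt : ∀ t < T, ε < u t
  next : ∀ t < T, η (t + 1) = η t + β * secantFactor η l u t * l t

namespace SecantTrace

variable {d m : ℕ} {P : Problem d m} {α β ε κ : ℝ} {η l u : ℕ → ℝ} {T t : ℕ}

/-- Writing entries of `l`, `u` from `T` on, or of `η` beyond `T`, leaves a trace intact. -/
lemma congr (h : SecantTrace P α β ε η l u T) {η' l' u' : ℕ → ℝ} (hη : ∀ t ≤ T, η' t = η t)
    (hl : ∀ t < T, l' t = l t) (hu : ∀ t < T, u' t = u t) :
    SecantTrace P α β ε η' l' u' T where
  l_le t ht := by rw [hl t ht, hη t ht.le]; exact h.l_le t ht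
  V_le t ht := by rw [hu t ht, hη t ht.le]; exact h.V_le t ht
  u_le t ht := by rw [hl t ht, hu t ht]; exact h.u_le t ht
  eps_lt t ht := by rw [hu t ht]; exact h.eps_lt t ht
  next t ht := by
    unfold secantFactor
    rw [hl t ht, hη t ht.le, hη (t + 1) ht, hη (t - 1) (by omega), hu (t - 1) (by omega)]
    exact h.next t ht

lemma zero (P : Problem d m) (α β ε : ℝ) (η l u : ℕ → ℝ) : SecantTrace P α β ε η l u 0 where
  l_le t ht := absurd ht (Nat.not_lt_zero t)
  V_le t ht := absurd ht (Nat.not_lt_zero t)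
  u_le t ht := absurd ht (Nat.not_lt_zero t)
  eps_lt t ht := absurd ht (Nat.not_lt_zero t)
  next t ht := absurd ht (Nat.not_lt_zero t)

lemma succ (h : SecantTrace P α β ε η l u T) (h1 : l T ≤ P.V (η T)) (h2 : P.V (η T) ≤ u T)
    (h3 : u T ≤ α * l T) (h4 : ε < u T)
    (h5 : η (T + 1) = η T + β * secantFactor η l u T * l T) :
    SecantTrace P α β ε η l u (T + 1) where
  l_le t ht := (Nat.lt_succ_iff_lt_or_eq.1 ht).elim (h.l_le t) (fun e => e ▸ h1)
  V_le t ht := (Nat.lt_succ_iff_lt_or_eq.1 ht).elim (h.V_le t) (fun e => e ▸ h2)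
  u_le t ht := (Nat.lt_succ_iff_lt_or_eq.1 ht).elim (h.u_le t) (fun e => e ▸ h3)
  eps_lt t ht := (Nat.lt_succ_iff_lt_or_eq.1 ht).elim (h.eps_lt t) (fun e => e ▸ h4)
  next t ht := (Nat.lt_succ_iff_lt_or_eq.1 ht).elim (h.next t) (fun e => e ▸ h5)

lemma l_pos (h : SecantTrace P α β ε η l u T) (hα : 1 < α) (hε : 0 < ε) (ht : t < T) :
    0 < l t := by
  have h1 := h.u_le t ht
  have h2 := h.eps_lt t ht
  by_contra! h3
  nlinarith

lemma eps_le (h : SecantTrace P α β ε η l u T) (ht : t < T) : ε ≤ α * l t :=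
  (h.eps_lt t ht).le.trans (h.u_le t ht)

lemma lt_next (h : SecantTrace P α β ε η l u T) (hα : 1 < α) (hε : 0 < ε) (hβ : 0 < β)
    (ht : t < T) : η t < η (t + 1) := by
  rw [h.next t ht]
  have h1 := h.l_pos hα hε ht
  have h2 := one_le_secantFactor η l u t
  have : 0 < β * secantFactor η l u t * l t := by positivity
  linarith

lemma lt_etaStar (h : SecantTrace P α β ε η l u T) (hP : P.Admissible) (hα : 1 < α) (hε : 0 < ε)
    (ht : t < T) : η t < P.etaStar :=
  hP.lt_etaStar_of_V_pos ((h.l_pos hα hε ht).trans_le (h.l_le t ht))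

/-- A convex function that is still positive at `η_{t+1}` and vanishes further right must be
strictly decreasing up to there. -/
lemma sub_pos (h : SecantTrace P α β ε η l u T) (hP : P.Admissible) (hα : 1 < α) (hε : 0 < ε)
    (hβ : 0 < β) (ht : t + 1 < T) : 0 < P.V (η t) - P.V (η (t + 1)) := by
  have h1 := h.lt_next hα hε hβ (Nat.lt_of_succ_lt ht)
  have h2 := h.lt_etaStar hP hα hε ht
  have h3 := hP.V_mul_sub_le h1.le h2.le
  have h4 := (h.l_pos hα hε ht).trans_le (h.l_le _ ht)
  exact pos_of_mul_pos_left (lt_of_lt_of_le (mul_pos h4 (by linarith)) h3) (by linarith)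

lemma le_sub (h : SecantTrace P α β ε η l u T) (ht : t + 1 < T) :
    P.V (η t) - P.V (η (t + 1)) ≤ u t - l (t + 1) := by
  linarith [h.V_le t (Nat.lt_of_succ_lt ht), h.l_le _ ht]

/-- A secant step does not overshoot the root. -/
lemma secantFactor_mul_V_le (h : SecantTrace P α β ε η l u T) (hP : P.Admissible) (hα : 1 < α)
    (hε : 0 < ε) (hβ : 0 < β) (ht : t < T) :
    secantFactor η l u t * P.V (η t) ≤ P.etaStar - η t := by
  have h1 := hP.V_le_etaStar_sub (h.lt_etaStar hP hα hε ht).le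
  cases t with
  | zero => simpa [secantFactor] using h1
  | succ t =>
    rw [secantFactor_succ]
    have h2 := h.sub_pos hP hα hε hβ ht
    have h3 := h.le_sub ht
    have h4 := h.lt_next hα hε hβ (Nat.lt_of_succ_lt ht)
    have h5 := h.lt_etaStar hP hα hε ht
    have h6 := hP.V_mul_sub_le h4.le h5.le
    rcases max_choice 1 ((η (t + 1) - η t) / (u t - l (t + 1))) with e | e <;> rw [e]
    · linarith
    -- The denominator `u_t - l_{t+1}` dominates the true drop of `V`, so the step is no longer than
    -- the exact secant step.
    · rw [div_mul_eq_mul_div, div_le_iff₀ (by linarith)]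
      nlinarith

lemma next_le_etaStar (h : SecantTrace P α β ε η l u T) (hP : P.Admissible) (hα : 1 < α)
    (hε : 0 < ε) (hβ : 0 < β) (hβ' : β ≤ 1) (ht : t < T) : η (t + 1) ≤ P.etaStar := by
  have h1 := h.secantFactor_mul_V_le hP hα hε hβ ht
  have h2 := one_le_secantFactor η l u t
  have h3 := h.l_pos hα hε ht
  have h4 : secantFactor η l u t * l t ≤ secantFactor η l u t * P.V (η t) := by
    gcongr; exact h.l_le t ht
  have h5 : 0 ≤ secantFactor η l u t * l t := by positivity
  rw [h.next t ht, mul_assoc]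
  nlinarith

/-- The value function at the next level, by extrapolation of its secant. -/
lemma le_V_next (h : SecantTrace P α β ε η l u T) (hP : P.Admissible) (hα : 1 < α)
    (hε : 0 < ε) (hβ : 0 < β) (ht : t < T) : (1 - β) * l t ≤ P.V (η (t + 1)) := by
  have hl := h.l_le t ht
  have hlt := h.lt_next hα hε hβ ht
  have hn := h.next t ht
  -- For the factor one the step is `β l_t`, and `V` falls at rate at most one.
  have h1 : secantFactor η l u t = 1 → (1 - β) * l t ≤ P.V (η (t + 1)) := by
    intro e
    have := hP.V_le_add hlt.le
    rw [hn, e] at this ⊢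
    linarith
  cases t with
  | zero => exact h1 (by simp [secantFactor])
  | succ t =>
    rw [secantFactor_succ] at h1 hn
    rcases max_choice 1 ((η (t + 1) - η t) / (u t - l (t + 1))) with e | e
    · exact h1 e
    rw [e] at hn
    have h2 := h.sub_pos hP hα hε hβ ht
    have h3 := h.le_sub ht
    have h4 := h.lt_next hα hε hβ (Nat.lt_of_succ_lt ht)
    -- Beyond `η_{t+1}` the function lies above its chord extended; the chord is no steeper than
    -- `(u_t - l_{t+1}) / (η_{t+1} - η_t)`, and at that slope the drop is `β l_{t+1}`.
    have h5 := hP.V_three_point h4.le hlt.le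
    have hd : 0 < u t - l (t + 1) := by linarith
    have h6 : (η (t + 1 + 1) - η (t + 1)) * (u t - l (t + 1)) =
        β * l (t + 1) * (η (t + 1) - η t) := by
      rw [hn]; field_simp; ring
    have h7 : (η (t + 1 + 1) - η (t + 1)) * (P.V (η t) - P.V (η (t + 1))) ≤
        (η (t + 1 + 1) - η (t + 1)) * (u t - l (t + 1)) :=
      mul_le_mul_of_nonneg_left h3 (by linarith)
    have h8 : 0 ≤ (η (t + 1) - η t) * (P.V (η (t + 1 + 1)) - P.V (η (t + 1)) + β * l (t + 1)) := by
      linarith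
    linarith [nonneg_of_mul_nonneg_right h8 (by linarith)]

/-- The previous step gives `σ_{t+1} ≥ β σ_t l_t / (u_t - l_{t+1})`, and AM-GM gives `l_{t+1} (u_t -
l_{t+1}) ≤ u_t² / 4 ≤ α² l_t² / 4`. The ratio is below one when `α < 2√β`. -/
lemma div_secantFactor_succ_le (h : SecantTrace P α β ε η l u T) (hP : P.Admissible)
    (hα : 1 < α) (hε : 0 < ε) (hβ : 0 < β) (ht : t + 1 < T) :
    l (t + 1) / secantFactor η l u (t + 1) ≤
      α ^ 2 / (4 * β) * (l t / secantFactor η l u t) := by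
  have ht' := Nat.lt_of_succ_lt ht
  have hd : 0 < u t - l (t + 1) := (h.sub_pos hP hα hε hβ ht).trans_le (h.le_sub ht)
  have h1 := h.l_pos hα hε ht
  have h2 := h.l_pos hα hε ht'
  have hs := one_le_secantFactor η l u t
  have h3 : (η (t + 1) - η t) / (u t - l (t + 1)) ≤ secantFactor η l u (t + 1) := by
    rw [secantFactor_succ]; exact le_max_right _ _
  rw [h.next t ht', add_sub_cancel_left] at h3
  have hu := h.u_le t ht'
  set σ := secantFactor η l u t
  calc l (t + 1) / secantFactor η l u (t + 1)
      ≤ l (t + 1) / (β * σ * l t / (u t - l (t + 1))) := by gcongr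
    _ = l (t + 1) * (u t - l (t + 1)) / (β * σ * l t) := by field_simp
    _ ≤ (α * l t) ^ 2 / 4 / (β * σ * l t) := by
        gcongr
        nlinarith [sq_nonneg (α * l t - 2 * l (t + 1))]
    _ = _ := by field_simp

lemma div_secantFactor_add_le (h : SecantTrace P α β ε η l u T) (hP : P.Admissible)
    (hα : 1 < α) (hε : 0 < ε) (hβ : 0 < β) (i : ℕ) (ht : t + i < T) :
    l (t + i) / secantFactor η l u (t + i) ≤ (α ^ 2 / (4 * β)) ^ i * l t := by
  induction i with
  | zero =>
    simpa using div_le_self (h.l_pos hα hε ht).le (one_le_secantFactor η l u t)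
  | succ i ih =>
    refine (h.div_secantFactor_succ_le hP hα hε hβ ht).trans ?_
    rw [pow_succ' (α ^ 2 / (4 * β)), mul_assoc]
    gcongr
    exact ih (by omega)

/-- No overshooting and growth combine to `κ σ V ≤ κ (η* - η) ≤ V`, with `V > 0`. -/
lemma mul_secantFactor_le_one (h : SecantTrace P α β ε η l u T) (hP : P.Admissible)
    (hα : 1 < α) (hε : 0 < ε) (hβ : 0 < β) (hκ : 0 ≤ κ) (ht : t < T)
    (hV : κ * (P.etaStar - η t) ≤ P.V (η t)) : κ * secantFactor η l u t ≤ 1 := by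
  have h1 := h.secantFactor_mul_V_le hP hα hε hβ ht
  have h2 := (h.l_pos hα hε ht).trans_le (h.l_le _ ht)
  have h3 := mul_le_mul_of_nonneg_left h1 hκ
  by_contra! h4
  nlinarith

/-- The contraction read backwards: since `α l` is still at least `ε` at the later level, the
earlier lower bound is geometrically larger. -/
lemma l_ge (h : SecantTrace P α β ε η l u T) (hP : P.Admissible)
    (hα : 1 < α) (hε : 0 < ε) (hβ : 0 < β) (hκ : 0 < κ)
    (hV : ∀ t < T, κ * (P.etaStar - η t) ≤ P.V (η t)) (i : ℕ) (ht : t + i < T) :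
    ε ≤ α / κ * (α ^ 2 / (4 * β)) ^ i * l t := by
  have h1 := h.div_secantFactor_add_le hP hα hε hβ i ht
  have h2 := h.mul_secantFactor_le_one hP hα hε hβ hκ.le ht (hV _ ht)
  have h3 := one_le_secantFactor η l u (t + i)
  have h4 := h.l_pos hα hε ht
  have h5 := h.eps_le ht
  set σ := secantFactor η l u (t + i)
  have h6 : σ ≤ 1 / κ := by rwa [le_div_iff₀' hκ]
  calc ε ≤ α * l (t + i) := h5
    _ = α * σ * (l (t + i) / σ) := by field_simp
    _ ≤ α * (1 / κ) * ((α ^ 2 / (4 * β)) ^ i * l t) := by gcongr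
    _ = _ := by ring

/-- The first `⌈log K / log (1/Q)⌉` terms count at most one each; after them `K Q^i ≤ 1` and a
geometric series remains. Truncation at one makes the dependence on `K` logarithmic. -/
lemma sum_min_le {K Q : ℝ} (hK : 1 ≤ K) (hQ : 0 < Q) (hQ' : Q < 1) (n : ℕ) :
    ∑ i ∈ Finset.range n, min 1 (K * Q ^ i) ≤
      Real.log K / Real.log (1 / Q) + 1 + 1 / (1 - Q) := by
  have hlog : 0 < Real.log (1 / Q) := Real.log_pos (by rw [lt_div_iff₀ hQ]; linarith)
  set N := ⌈Real.log K / Real.log (1 / Q)⌉₊ with hN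
  have hN1 : (N : ℝ) ≤ Real.log K / Real.log (1 / Q) + 1 :=
    (Nat.ceil_lt_add_one (div_nonneg (Real.log_nonneg hK) hlog.le)).le
  have hKN : K * Q ^ N ≤ 1 := by
    have h1 : Real.log K / Real.log (1 / Q) ≤ N := Nat.le_ceil _
    rw [div_le_iff₀ hlog] at h1
    have h2 : Real.log (K * Q ^ N) ≤ 0 := by
      rw [Real.log_mul (by positivity) (by positivity), Real.log_pow]
      rw [one_div, Real.log_inv] at h1
      linarith
    exact (Real.log_nonpos_iff (by positivity)).1 h2
  have hsub : ∑ i ∈ Finset.range n, min 1 (K * Q ^ i) ≤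
      ∑ i ∈ Finset.range (N + n), min 1 (K * Q ^ i) := by
    refine Finset.sum_le_sum_of_subset_of_nonneg (by simp) fun i _ _ => ?_
    positivity
  rw [Finset.sum_range_add] at hsub
  have h1 : ∑ i ∈ Finset.range N, min 1 (K * Q ^ i) ≤ N := by
    calc _ ≤ ∑ i ∈ Finset.range N, (1 : ℝ) := Finset.sum_le_sum fun i _ => min_le_left _ _
      _ = N := by simp
  have h2 : ∑ i ∈ Finset.range n, min 1 (K * Q ^ (N + i)) ≤ 1 / (1 - Q) := by
    calc _ ≤ ∑ i ∈ Finset.range n, Q ^ i := by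
          refine Finset.sum_le_sum fun i _ => (min_le_right _ _).trans ?_
          rw [pow_add, ← mul_assoc]
          exact mul_le_of_le_one_left (by positivity) hKN
      _ ≤ ∑' i, Q ^ i := Summable.sum_le_tsum _ (fun i _ => by positivity)
            (summable_geometric_of_lt_one hQ.le hQ')
      _ = 1 / (1 - Q) := by rw [tsum_geometric_of_lt_one hQ.le hQ', one_div]
  linarith

/-- The summed budgets of the secant steps. -/
lemma sum_budget_le (h : SecantTrace P α β ε η l u T) (hP : P.Admissible)
    (hα : 1 < α) (hε : 0 < ε) (hβ : 0 < β) (hκ : 0 < κ) (hκ' : κ ≤ 1)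
    (hV : ∀ t < T, κ * (P.etaStar - η t) ≤ P.V (η t)) (hq : α ^ 2 / (4 * β) < 1) {p : ℝ}
    (hp : 0 < p) :
    ∑ j ∈ Finset.range T, (1 / max ε (P.V (η j))) ^ p ≤
      (1 / ε) ^ p * (p * (Real.log α + Real.log (1 / κ)) /
        Real.log (1 / (α ^ 2 / (4 * β)) ^ p) + 1 + 1 / (1 - (α ^ 2 / (4 * β)) ^ p)) := by
  set q := α ^ 2 / (4 * β) with hqdef
  have hq0 : 0 < q := by positivity
  have hακ : 1 ≤ α / κ := by rw [le_div_iff₀ hκ]; linarith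
  have hs := sum_min_le (K := (α / κ) ^ p) (Q := q ^ p) (Real.one_le_rpow hακ hp.le)
    (by positivity) (Real.rpow_lt_one hq0.le hq hp) T
  rw [Real.log_rpow (by positivity), div_eq_mul_one_div α κ,
    Real.log_mul (by positivity) (by positivity)] at hs
  -- Levels are counted backwards from the last one left.
  rw [← Finset.sum_range_reflect]
  refine le_trans ?_ (mul_le_mul_of_nonneg_left hs (by positivity))
  rw [Finset.mul_sum]
  refine Finset.sum_le_sum fun i hi => ?_
  have hi := Finset.mem_range.1 hi
  have h1 := h.l_ge hP hα hε hβ hκ hV (t := T - 1 - i) i (by omega)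
  have hl := h.l_pos hα hε (t := T - 1 - i) (by omega)
  have h2 := h.l_le (T - 1 - i) (by omega)
  set W := P.V (η (T - 1 - i))
  have hW : 0 < max ε W := lt_max_of_lt_left hε
  rw [mul_min_of_nonneg _ _ (by positivity), mul_one]
  refine le_min ?_ ?_
  · gcongr; exact le_max_left _ _
  · rw [← Real.rpow_natCast (q ^ p), ← Real.rpow_mul hq0.le, mul_comm p, Real.rpow_mul hq0.le,
      Real.rpow_natCast, ← Real.mul_rpow (by positivity) (by positivity),
      ← Real.mul_rpow (by positivity) (by positivity)]
    refine Real.rpow_le_rpow (by positivity) ?_ hp.le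
    rw [div_le_iff₀ hW, ← mul_div_assoc, mul_one]
    have h3 : α / κ * q ^ i * l (T - 1 - i) ≤ α / κ * q ^ i * max ε W := by
      gcongr; exact h2.trans (le_max_right _ _)
    rw [one_div_mul_eq_div, div_mul_eq_mul_div, le_div_iff₀ hε]
    linarith

end SecantTrace

end LevelSet

/-! ### The while loop: invariants, progress, output. -/

namespace LevelSet

variable {d m : ℕ} {P : Problem d m} {α β ν ε : ℝ}

namespace SecantState

lemma nextLevel_eq (s : SecantState d) :
    s.nextLevel β = s.η s.t + β * secantFactor s.η s.l s.u s.t * s.l s.t := by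
  unfold nextLevel secantFactor
  split_ifs <;> simp

/-- The facts that hold throughout the while loop. -/
structure Valid (P : Problem d m) (α β ε : ℝ) (s : SecantState d) : Prop where
  trace : SecantTrace P α β ε s.η s.l s.u s.t
  lTilde_eq : ∀ t < s.t, s.lTilde (t + 1) = (1 - β) * s.l t
  fBar_le : P.fBar ≤ s.η 0
  lt_etaStar : s.η 0 < P.etaStar
  idle : s.apl = none → s.x s.t ∈ P.X ∧ s.u s.t = P.v (s.x s.t) (s.η s.t) ∧
    s.l s.t ≤ P.V (s.η s.t) ∧ ¬ AplGuard P α ε (s.η s.t) (s.x s.t) (s.l s.t)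
  busy : ∀ a, s.apl = some a → 0 < s.t ∧ a.Valid P (s.η s.t)

lemma Valid.start (hP : P.Admissible) (hα : 1 < α) (hε : 0 < ε) {x : EuclideanSpace ℝ (Fin d)}
    {η₀ l₀ : ℝ} (h : InitReturns P α ε x η₀ l₀) :
    (SecantState.start P x η₀ l₀).Valid P α β ε := by
  obtain ⟨hx, hl, hg, hv, hf⟩ := h.valid hP hα hε
  have h1 := le_mul_of_not_aplGuard hα hg hv
  refine ⟨SecantTrace.zero .., fun t ht => absurd ht (Nat.not_lt_zero t), hf,
    hP.lt_etaStar_of_V_pos ?_, fun _ => ⟨hx, rfl, hl, hg⟩, fun a ha => by cases ha⟩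
  change 0 < P.V η₀
  by_contra! h2
  nlinarith

lemma update_of_le {γ : Type*} (f : ℕ → γ) {t T : ℕ} (h : t ≤ T) (c : γ) :
    Function.update f (T + 1) c t = f t :=
  Function.update_of_ne (by omega) _ _

lemma update_of_lt {γ : Type*} (f : ℕ → γ) {t T : ℕ} (h : t < T) (c : γ) :
    Function.update f T c t = f t :=
  Function.update_of_ne (by omega) _ _

/-- Entering a new iteration extends the trace. -/
lemma Valid.trace_enter (hα : 1 < α) (hP : P.Admissible) {s : SecantState d}
    (h : s.Valid P α β ε) (h1 : s.apl = none) (h2 : ε < s.u s.t) :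
    SecantTrace P α β ε (Function.update s.η (s.t + 1) (s.nextLevel β)) s.l s.u (s.t + 1) := by
  obtain ⟨hx, hu, hl, hg⟩ := h.idle h1
  have hT := h.trace.congr (η' := Function.update s.η (s.t + 1) (s.nextLevel β))
    (fun t ht => update_of_le _ ht _) (fun _ _ => rfl) (fun _ _ => rfl)
  refine hT.succ ?_ ?_ ?_ h2 ?_
  · rwa [update_of_le _ le_rfl]
  · rw [update_of_le _ le_rfl, hu]
    exact hP.V_le_v hx _
  · rw [hu] at h2 ⊢
    exact le_mul_of_not_aplGuard hα hg h2
  · rw [Function.update_self, update_of_le _ le_rfl, s.nextLevel_eq]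
    unfold secantFactor
    rw [update_of_le _ le_rfl, update_of_le _ (by omega)]

lemma Valid.step (hP : P.Admissible) (hα : 1 < α) (hε : 0 < ε) (hβ : 0 < β)
    {s s' : SecantState d} (h : s.Valid P α β ε) (hs : SecantStep P α β ν ε s s') :
    s'.Valid P α β ε := by
  cases hs with
  | enter h1 h2 =>
    have hT := h.trace_enter hα hP h1 h2
    obtain ⟨hx, hu, hl, hg⟩ := h.idle h1
    refine ⟨hT, fun t ht => ?_, ?_, ?_, fun h => (by cases h), fun a ha => ?_⟩
    · change Function.update s.lTilde (s.t + 1) _ (t + 1) = (1 - β) * s.l t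
      have ht : t < s.t + 1 := ht
      rcases Nat.lt_succ_iff_lt_or_eq.1 ht with ht | rfl
      · rw [update_of_le _ ht]; exact h.lTilde_eq t ht
      · rw [Function.update_self]
    · simpa [update_of_le] using h.fBar_le
    · simpa [update_of_le] using h.lt_etaStar
    · obtain rfl := Option.some.inj ha
      exact ⟨Nat.succ_pos _, hx, hT.le_V_next hP hα hε hβ (Nat.lt_succ_self _)⟩
  | inner a a' n ha hst =>
    refine ⟨h.trace, h.lTilde_eq, h.fBar_le, h.lt_etaStar, fun h => (by cases h), fun b hb => ?_⟩
    obtain rfl := Option.some.inj hb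
    exact ⟨(h.busy a ha).1, (h.busy a ha).2.step hP hα hε hst⟩
  | finish w lw ha hg =>
    obtain ⟨hw, hlw⟩ := (h.busy _ ha).2
    refine ⟨h.trace.congr (fun _ _ => rfl) (fun t ht => update_of_lt _ ht _)
      (fun t ht => update_of_lt _ ht _), fun t ht => ?_, h.fBar_le, h.lt_etaStar,
      fun _ => ?_, fun a ha => by cases ha⟩
    · exact (h.lTilde_eq t ht).trans (by simp only [update_of_lt _ ht])
    · simp only [Function.update_self]
      exact ⟨hw, trivial, hlw, hg⟩

lemma Valid.le_etaStar (hP : P.Admissible) (hα : 1 < α) (hε : 0 < ε) (hβ : 0 < β) (hβ' : β ≤ 1)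
    {s : SecantState d} (h : s.Valid P α β ε) : ∀ t ≤ s.t, s.η t ≤ P.etaStar
  | 0, _ => h.lt_etaStar.le
  | _ + 1, ht => h.trace.next_le_etaStar hP hα hε hβ hβ' ht

lemma Valid.zero_le (hα : 1 < α) (hε : 0 < ε) (hβ : 0 < β)
    {s : SecantState d} (h : s.Valid P α β ε) : ∀ t ≤ s.t, s.η 0 ≤ s.η t
  | 0, _ => le_rfl
  | t + 1, ht => (h.zero_le hα hε hβ t (Nat.le_of_succ_le ht)).trans (h.trace.lt_next hα hε hβ ht).le

lemma Valid.V_le (hP : P.Admissible) (hα : 1 < α) (hε : 0 < ε) (hβ : 0 < β) (hβ' : β ≤ 1)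
    {s : SecantState d} (h : s.Valid P α β ε) {t : ℕ} (ht : t ≤ s.t) :
    P.etaStar - s.η t ≤ P.fStar - P.fBar ∧ P.V (s.η t) ≤ P.fStar - P.fBar := by
  have h1 := hP.V_le_etaStar_sub (h.le_etaStar hP hα hε hβ hβ' t ht)
  have h2 := h.zero_le hα hε hβ t ht
  have h3 := h.fBar_le
  rw [hP.etaStar_eq_fStar] at h1 ⊢
  exact ⟨by linarith, by linarith⟩

/-- The method does not get stuck. -/
lemma Valid.exists_step (hP : P.Admissible) (hν : 1 / 2 < ν) {s : SecantState d}
    (h : s.Valid P α β ε) (hs : ¬ s.Halted ε) : ∃ s', SecantStep P α β ν ε s s' := by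
  rcases ha : s.apl with _ | a
  · by_cases hu : s.u s.t ≤ ε
    · exact absurd ⟨ha, hu⟩ hs
    · exact ⟨_, .enter s ha (not_le.1 hu)⟩
  · have hv := (h.busy a ha).2
    obtain ⟨x, l, _ | q⟩ := a
    · by_cases hg : AplGuard P α ε (s.η s.t) x l
      · exact ⟨_, .inner s _ _ _ ha (.call x l hg)⟩
      · exact ⟨_, .finish s x l ha hg⟩
    · obtain ⟨n, a', hst⟩ := AplState.Valid.exists_step_some (α := α) (ε := ε) (θ := 2 * ν - 1)
        (x := x) (l := l) hP (by linarith) hv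
      exact ⟨_, .inner s _ _ _ ha hst⟩

lemma Valid.lTilde (hP : P.Admissible) (hα : 1 < α) (hε : 0 < ε) (hβ : 0 < β) (hβ' : β ≤ 1)
    {s : SecantState d} (h : s.Valid P α β ε) {t : ℕ} (ht : 1 ≤ t) (ht' : t ≤ s.t) :
    0 ≤ s.lTilde t ∧ (β < 1 → 0 < s.lTilde t) ∧ s.lTilde t ≤ P.V (s.η t) := by
  obtain ⟨t, rfl⟩ := Nat.exists_eq_add_of_le' ht
  rw [h.lTilde_eq t ht']
  have h1 := h.trace.l_pos hα hε ht'
  exact ⟨mul_nonneg (by linarith) h1.le, fun h => mul_pos (by linarith) h1,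
    h.trace.le_V_next hP hα hε hβ ht'⟩

lemma Valid.halted (hP : P.Admissible) (hα : 1 < α) (hε : 0 < ε) (hβ : 0 < β) (hβ' : β ≤ 1)
    {s : SecantState d} (h : s.Valid P α β ε) (hs : s.Halted ε) :
    (∀ r : ℝ, P.IsSubgradientV P.etaStar r → r < 0 → P.etaStar - s.η s.t ≤ ε / (-r)) ∧
      P.EpsOptimal ε (s.x s.t) := by
  obtain ⟨hx, hu, -, -⟩ := h.idle hs.1
  have hv : P.v (s.x s.t) (s.η s.t) ≤ ε := hu ▸ hs.2
  have hη := h.le_etaStar hP hα hε hβ hβ' s.t le_rfl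
  refine ⟨fun r hr hr0 => ?_, hx, ?_, ?_⟩
  · have h1 := hr (s.η s.t)
    rw [hP.V_etaStar] at h1
    rw [le_div_iff₀ (by linarith)]
    linarith [hP.V_le_v hx (s.η s.t)]
  · rw [← hP.etaStar_eq_fStar]
    linarith [P.f_sub_le_v (s.x s.t) (s.η s.t)]
  · refine (pi_norm_le_iff_of_nonneg hε.le).2 fun i => ?_
    rw [Real.norm_of_nonneg (le_max_right _ _)]
    exact max_le ((P.g_le_v _ _ i).trans hv) hε.le

/-! ### Oracle calls of the while loop. -/

/-- The budget of the while loop: `K (1 / max ε V(η_t))^p` oracle calls in iteration `t`. -/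
def CostBound (P : Problem d m) (α ε θ M D ρ B U K : ℝ) (s : SecantState d) : Prop :=
  (s.apl = none → (s.calls : ℝ) ≤ ∑ j ∈ Finset.range s.t,
    K * (1 / max ε (P.V (s.η (j + 1)))) ^ (2 / (1 + 3 * ρ))) ∧
  ∀ a, s.apl = some a → ∃ n, AplState.Cost P α ε (s.η s.t) θ M D ρ B U n a ∧
    (s.calls : ℝ) ≤ ∑ j ∈ Finset.range (s.t - 1),
      K * (1 / max ε (P.V (s.η (j + 1)))) ^ (2 / (1 + 3 * ρ)) + 2 + n

variable {M D ρ B U K Δ : ℝ}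

/-- The `3` is the overhead of an iteration outside the APL method: two calls on entering, one on
finishing. -/
lemma budget_le (hρ : 0 ≤ ρ) (hα : 1 < α) {w : ℝ} (hw : 0 < w) (hwU : w ≤ U)
    (hK : K = 3 * U ^ (2 / (1 + 3 * ρ)) + B / ((α - 1) / α) ^ (2 / (1 + 3 * ρ))) {c : ℝ}
    (hc : c ≤ B / ((α - 1) / α * w) ^ (2 / (1 + 3 * ρ))) :
    c + 3 ≤ K * (1 / w) ^ (2 / (1 + 3 * ρ)) := by
  have hc0 : 0 < (α - 1) / α := div_pos (by linarith) (by linarith)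
  set p := 2 / (1 + 3 * ρ)
  have hp : 0 ≤ p := by positivity
  rw [Real.mul_rpow hc0.le hw.le] at hc
  have hwp : 0 < w ^ p := by positivity
  have h1 : 1 ≤ U ^ p / w ^ p := by rw [one_le_div hwp]; gcongr
  rw [hK, Real.div_rpow zero_le_one hw.le, Real.one_rpow]
  calc c + 3 ≤ B / (((α - 1) / α) ^ p * w ^ p) + 3 * (U ^ p / w ^ p) := by linarith
    _ = _ := by field_simp; ring

lemma CostBound.step (hP : P.Admissible) (hM : P.HolderSmooth ρ M) (hM0 : 0 ≤ M) (hD : 0 < D)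
    (hdiam : Metric.diam P.X ≤ D) (hρ : 0 ≤ ρ) (hρ' : ρ ≤ 1) (hν : 1 / 2 < ν) (hν' : ν < 1)
    (hα : 1 < α) (hβ : 0 < β) (hβ' : β ≤ 1) (hε : 0 < ε) (hεΔ : ε ≤ Δ)
    (hΔ : P.fStar - P.fBar ≤ Δ) (hB0 : 0 ≤ B)
    (hB : B * ((1 + (2 * ν - 1)) / 2) ^ (2 / (1 + 3 * ρ)) + 4 * (α * Δ) ^ (2 / (1 + 3 * ρ)) +
      2 * (8 * M * D ^ (1 + ρ) / (2 * ν - 1)) ^ (2 / (1 + 3 * ρ)) ≤ B)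
    (hK : K = 3 * (α * Δ) ^ (2 / (1 + 3 * ρ)) + B / ((α - 1) / α) ^ (2 / (1 + 3 * ρ)))
    {s s' : SecantState d} (hv : s.Valid P α β ε)
    (h : s.CostBound P α ε (2 * ν - 1) M D ρ B (α * Δ) K) (hs : SecantStep P α β ν ε s s') :
    s'.CostBound P α ε (2 * ν - 1) M D ρ B (α * Δ) K := by
  cases hs with
  | enter h1 h2 =>
    obtain ⟨hx, hu, hl, hg⟩ := hv.idle h1
    have hT := hv.trace_enter hα hP h1 h2
    refine ⟨fun h => (by cases h), fun a ha => ?_⟩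
    obtain rfl := Option.some.inj ha
    refine ⟨0, AplState.Cost.start hα hε hB0 (by linarith) ?_, ?_⟩
    · simp only [Function.update_self]
      -- Source of the gap bound `U = α Δ`: raising the level does not raise `v`, so the initial gap
      -- is at most `u_t ≤ α l_t ≤ α V(η_t) ≤ α Δ`.
      have h3 := hT.lt_next hα hε hβ (Nat.lt_succ_self s.t)
      rw [update_of_le _ le_rfl, Function.update_self] at h3
      have h4 := P.v_antitone (s.x s.t) h3.le
      have h5 := hT.u_le s.t (Nat.lt_succ_self _)
      have h6 := hT.l_pos hα hε (Nat.lt_succ_self _)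
      have h7 := (hv.V_le hP hα hε hβ hβ' le_rfl).2
      have h8 : 0 ≤ (1 - β) * s.l s.t := mul_nonneg (by linarith) h6.le
      nlinarith
    · have h3 := h.1 h1
      simp only [Nat.add_sub_cancel]
      push_cast
      rw [add_zero]
      gcongr
      refine h3.trans (le_of_eq (Finset.sum_congr rfl fun j hj => ?_))
      rw [update_of_le _ (Nat.succ_le_of_lt (Finset.mem_range.1 hj))]
  | inner a a' n ha hst =>
    refine ⟨fun h => (by cases h), fun b hb => ?_⟩
    obtain rfl := Option.some.inj hb
    obtain ⟨n', h1, h2⟩ := h.2 a ha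
    refine ⟨n' + n, h1.step hP hM hM0 hD hdiam hρ hρ' (by linarith) (by linarith) hα hε hB0 hB
      (hv.busy a ha).2 hst, ?_⟩
    simp only
    push_cast
    linarith
  | finish w lw ha hg =>
    refine ⟨fun _ => ?_, fun a h => (by cases h)⟩
    obtain ⟨n, h1, h2⟩ := h.2 _ ha
    obtain ⟨ht, hav⟩ := hv.busy _ ha
    have h3 := h1.le hP hM0 hD hdiam hρ (by linarith) hα hε hB0 hB hav
    have hm : max ε (P.V (s.η s.t)) ≤ Δ :=
      max_le hεΔ ((hv.V_le hP hα hε hβ hβ' le_rfl).2.trans hΔ)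
    have h4 := budget_le hρ hα (lt_max_of_lt_left hε) (hm.trans (by nlinarith)) hK h3
    simp only
    push_cast
    obtain ⟨t, ht'⟩ : ∃ t, s.t = t + 1 := ⟨s.t - 1, by omega⟩
    rw [ht'] at h2 h4 ⊢
    rw [Finset.sum_range_succ]
    rw [Nat.add_sub_cancel] at h2
    linarith

lemma CostBound.calls_le (hP : P.Admissible) (hM0 : 0 ≤ M) (hD : 0 < D)
    (hdiam : Metric.diam P.X ≤ D) (hρ : 0 ≤ ρ) (hν : 1 / 2 < ν)
    (hα : 1 < α) (hβ : 0 < β) (hβ' : β ≤ 1) (hε : 0 < ε) (hεΔ : ε ≤ Δ)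
    (hΔ : P.fStar - P.fBar ≤ Δ) (hB0 : 0 ≤ B)
    (hB : B * ((1 + (2 * ν - 1)) / 2) ^ (2 / (1 + 3 * ρ)) + 4 * (α * Δ) ^ (2 / (1 + 3 * ρ)) +
      2 * (8 * M * D ^ (1 + ρ) / (2 * ν - 1)) ^ (2 / (1 + 3 * ρ)) ≤ B)
    (hK : K = 3 * (α * Δ) ^ (2 / (1 + 3 * ρ)) + B / ((α - 1) / α) ^ (2 / (1 + 3 * ρ)))
    {s : SecantState d} (hv : s.Valid P α β ε)
    (h : s.CostBound P α ε (2 * ν - 1) M D ρ B (α * Δ) K) :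
    (s.calls : ℝ) ≤ ∑ j ∈ Finset.range s.t,
      K * (1 / max ε (P.V (s.η (j + 1)))) ^ (2 / (1 + 3 * ρ)) := by
  rcases ha : s.apl with _ | a
  · exact h.1 ha
  obtain ⟨n, h1, h2⟩ := h.2 _ ha
  obtain ⟨ht, hav⟩ := hv.busy _ ha
  have h3 := h1.le hP hM0 hD hdiam hρ (by linarith) hα hε hB0 hB hav
  have hm : max ε (P.V (s.η s.t)) ≤ Δ :=
    max_le hεΔ ((hv.V_le hP hα hε hβ hβ' le_rfl).2.trans hΔ)
  have h4 := budget_le hρ hα (lt_max_of_lt_left hε) (hm.trans (by nlinarith)) hK h3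
  obtain ⟨t, ht'⟩ : ∃ t, s.t = t + 1 := ⟨s.t - 1, by omega⟩
  rw [ht'] at h2 h4 ⊢
  rw [Finset.sum_range_succ]
  rw [Nat.add_sub_cancel] at h2
  linarith

/-- The oracle complexity in terms of the growth `κ` of the value function at the levels that the
method leaves. -/
lemma Valid.sum_budget_le (hP : P.Admissible) (hα : 1 < α) (hβ : 0 < β) (hε : 0 < ε)
    (hρ : 0 ≤ ρ) (hq : α ^ 2 / (4 * β) < 1) (hK : 0 ≤ K) {κ : ℝ} (hκ : 0 < κ) (hκ' : κ ≤ 1)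
    {s : SecantState d} (h : s.Valid P α β ε)
    (hV : ∀ t < s.t, κ * (P.etaStar - s.η t) ≤ P.V (s.η t)) :
    ∑ j ∈ Finset.range s.t, K * (1 / max ε (P.V (s.η (j + 1)))) ^ (2 / (1 + 3 * ρ)) ≤
      K * (2 + 1 / (1 - (α ^ 2 / (4 * β)) ^ (2 / (1 + 3 * ρ))) +
        2 / (1 + 3 * ρ) * (Real.log α + 1) /
          Real.log (1 / (α ^ 2 / (4 * β)) ^ (2 / (1 + 3 * ρ)))) *
        (1 + Real.log (1 / κ)) * (1 / ε) ^ (2 / (1 + 3 * ρ)) := by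
  have hp : 0 < 2 / (1 + 3 * ρ) := by positivity
  have h1 := h.trace.sum_budget_le hP hα hε hβ hκ hκ' hV hq hp
  set p := 2 / (1 + 3 * ρ)
  have hq0 : 0 < α ^ 2 / (4 * β) := by positivity
  set Q := (α ^ 2 / (4 * β)) ^ p
  have hQ : 0 < Q := by positivity
  have hQ' : Q < 1 := Real.rpow_lt_one hq0.le hq hp
  have hL : 0 < Real.log (1 / Q) := Real.log_pos (by rw [lt_div_iff₀ hQ]; linarith)
  have hκl : 0 ≤ Real.log (1 / κ) := Real.log_nonneg (by rw [le_div_iff₀ hκ]; linarith)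
  have hαl : 0 ≤ Real.log α := Real.log_nonneg hα.le
  -- The calls are charged to the levels `1, …, t`, while growth is known for `0, …, t - 1`; the
  -- current level is charged the maximal `(1 / ε)^p`.
  have h2 : ∑ j ∈ Finset.range s.t, (1 / max ε (P.V (s.η (j + 1)))) ^ p ≤
      ∑ j ∈ Finset.range s.t, (1 / max ε (P.V (s.η j))) ^ p + (1 / ε) ^ p := by
    have e := Finset.sum_range_succ' (fun j => (1 / max ε (P.V (s.η j))) ^ p) s.t
    rw [Finset.sum_range_succ] at e
    have h3 : 0 ≤ (1 / max ε (P.V (s.η 0))) ^ p :=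
      Real.rpow_nonneg (div_nonneg zero_le_one (hε.le.trans (le_max_left _ _))) _
    have h4 : (1 / max ε (P.V (s.η s.t))) ^ p ≤ (1 / ε) ^ p := by
      have : 0 < max ε (P.V (s.η s.t)) := lt_max_of_lt_left hε
      gcongr
      exact le_max_left _ _
    linarith
  rw [← Finset.mul_sum]
  have hE : 0 ≤ (1 / ε) ^ p := by positivity
  have hQ1 : 0 < 1 - Q := by linarith
  have h5 : p * (Real.log α + Real.log (1 / κ)) / Real.log (1 / Q) + 1 + 1 / (1 - Q) + 1 ≤
      (2 + 1 / (1 - Q) + p * (Real.log α + 1) / Real.log (1 / Q)) * (1 + Real.log (1 / κ)) := by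
    have h6 : Real.log α + Real.log (1 / κ) ≤ (Real.log α + 1) * (1 + Real.log (1 / κ)) := by
      nlinarith [mul_nonneg hαl hκl]
    have h7 : p * (Real.log α + Real.log (1 / κ)) / Real.log (1 / Q) ≤
        p * ((Real.log α + 1) * (1 + Real.log (1 / κ))) / Real.log (1 / Q) := by gcongr
    have h8 : 0 ≤ (2 + 1 / (1 - Q)) * Real.log (1 / κ) := by positivity
    calc _ ≤ p * ((Real.log α + 1) * (1 + Real.log (1 / κ))) / Real.log (1 / Q) +
          (2 + 1 / (1 - Q)) + (2 + 1 / (1 - Q)) * Real.log (1 / κ) := by linarith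
      _ = _ := by ring
  calc K * ∑ j ∈ Finset.range s.t, (1 / max ε (P.V (s.η (j + 1)))) ^ p
      ≤ K * ((1 / ε) ^ p * (p * (Real.log α + Real.log (1 / κ)) / Real.log (1 / Q) + 1 +
          1 / (1 - Q)) + (1 / ε) ^ p) := by gcongr; linarith
    _ = K * ((1 / ε) ^ p * (p * (Real.log α + Real.log (1 / κ)) / Real.log (1 / Q) + 1 +
          1 / (1 - Q) + 1)) := by ring
    _ ≤ K * ((1 / ε) ^ p * ((2 + 1 / (1 - Q) + p * (Real.log α + 1) / Real.log (1 / Q)) *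
          (1 + Real.log (1 / κ)))) := by gcongr
    _ = _ := by ring

end SecantState

lemma Reachable.valid (hP : P.Admissible) (hα : 1 < α) (hε : 0 < ε) (hβ : 0 < β)
    {s : SecantState d} (h : Reachable P α β ν ε s) : s.Valid P α β ε := by
  obtain ⟨x, η₀, l₀, hi, hr⟩ := h
  induction hr with
  | refl => exact SecantState.Valid.start hP hα hε hi
  | tail _ hs ih => exact ih.step hP hα hε hβ hs

/-- The oracle complexity of the while loop, for any growth `κ` of the value function at the
levels that the method leaves. -/
lemma exists_calls_le (hα : 1 < α) (hβ : 0 < β) (hβ' : β ≤ 1) (hq : α ^ 2 / (4 * β) < 1)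
    (hν : 1 / 2 < ν) (hν' : ν < 1) {ρ : ℝ} (hρ : 0 ≤ ρ) (hρ' : ρ ≤ 1) {M D Δ : ℝ} (hM0 : 0 ≤ M)
    (hD : 0 < D) (hΔ0 : 1 ≤ Δ) :
    ∃ C : ℝ, 0 < C ∧ ∀ (d m : ℕ) (P : Problem d m), P.Admissible → P.HolderSmooth ρ M →
      Metric.diam P.X ≤ D → P.fStar - P.fBar ≤ Δ → ∀ ε : ℝ, 0 < ε → ε ≤ 1 / 2 →
      ∀ s : SecantState d, Reachable P α β ν ε s → ∀ κ : ℝ, 0 < κ → κ ≤ 1 →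
      (∀ t < s.t, κ * (P.etaStar - s.η t) ≤ P.V (s.η t)) →
      (s.calls : ℝ) ≤ C * (1 + Real.log (1 / κ)) * (1 / ε) ^ (2 / (1 + 3 * ρ)) := by
  have hp : 0 < 2 / (1 + 3 * ρ) := by positivity
  have hνp : ν ^ (2 / (1 + 3 * ρ)) < 1 := Real.rpow_lt_one (by linarith) hν' hp
  have hθ : 0 < 2 * ν - 1 := by linarith
  obtain ⟨A, hA⟩ : ∃ A, A = 4 * (α * Δ) ^ (2 / (1 + 3 * ρ)) +
      2 * (8 * M * D ^ (1 + ρ) / (2 * ν - 1)) ^ (2 / (1 + 3 * ρ)) := ⟨_, rfl⟩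
  have hA0 : 0 ≤ A := by rw [hA]; positivity
  -- Solution of the fixed point equation `B ν^p + A = B`.
  obtain ⟨B, hB⟩ : ∃ B, B = A / (1 - ν ^ (2 / (1 + 3 * ρ))) := ⟨_, rfl⟩
  have hB0 : 0 ≤ B := by rw [hB]; exact div_nonneg hA0 (by linarith)
  have hBle : B * ((1 + (2 * ν - 1)) / 2) ^ (2 / (1 + 3 * ρ)) +
      4 * (α * Δ) ^ (2 / (1 + 3 * ρ)) +
      2 * (8 * M * D ^ (1 + ρ) / (2 * ν - 1)) ^ (2 / (1 + 3 * ρ)) ≤ B := by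
    rw [show (1 + (2 * ν - 1)) / 2 = ν by ring, add_assoc, ← hA]
    have h1 : 1 - ν ^ (2 / (1 + 3 * ρ)) ≠ 0 := by linarith
    have : B * (1 - ν ^ (2 / (1 + 3 * ρ))) = A := by rw [hB]; field_simp
    linarith
  have hc : 0 < (α - 1) / α := div_pos (by linarith) (by linarith)
  obtain ⟨K, hK⟩ : ∃ K, K = 3 * (α * Δ) ^ (2 / (1 + 3 * ρ)) +
    B / ((α - 1) / α) ^ (2 / (1 + 3 * ρ)) := ⟨_, rfl⟩
  have hK0 : 0 < K := by rw [hK]; positivity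
  have hq0 : 0 < α ^ 2 / (4 * β) := by positivity
  have hQ' : (α ^ 2 / (4 * β)) ^ (2 / (1 + 3 * ρ)) < 1 := Real.rpow_lt_one hq0.le hq hp
  refine ⟨K * (2 + 1 / (1 - (α ^ 2 / (4 * β)) ^ (2 / (1 + 3 * ρ))) +
    2 / (1 + 3 * ρ) * (Real.log α + 1) / Real.log (1 / (α ^ 2 / (4 * β)) ^ (2 / (1 + 3 * ρ)))),
    ?_, fun d m P hP hM hdiam hΔ ε hε hε' s hs κ hκ hκ' hV => ?_⟩
  rotate_left
  · have hv := hs.valid hP hα hε hβ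
    refine le_trans ?_ (hv.sum_budget_le hP hα hβ hε hρ hq hK0.le hκ hκ' hV)
    refine SecantState.CostBound.calls_le hP hM0 hD hdiam hρ hν hα hβ hβ' hε (by linarith) hΔ
      hB0 hBle hK hv ?_
    obtain ⟨x, η₀, l₀, hi, hr⟩ := hs
    clear hv hV
    induction hr with
    | refl => exact ⟨fun _ => by simp [SecantState.start], fun a ha => by cases ha⟩
    | tail hr hst ih =>
      exact ih.step hP hM hM0 hD hdiam hρ hρ' hν hν' hα hβ hβ' hε (by linarith) hΔ
        hB0 hBle hK (Reachable.valid hP hα hε hβ ⟨x, η₀, l₀, hi, hr⟩) hst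
  · have hL : 0 < Real.log (1 / (α ^ 2 / (4 * β)) ^ (2 / (1 + 3 * ρ))) :=
      Real.log_pos (by rw [lt_div_iff₀ (by positivity)]; linarith)
    have h1 : 0 < 1 - (α ^ 2 / (4 * β)) ^ (2 / (1 + 3 * ρ)) := by linarith
    have h2 : 0 < Real.log α := Real.log_pos hα
    positivity

end LevelSet

/-! ### The two choices of the growth constant `κ`. -/

theorem mainTheorem3 (α β ν : ℝ) (hβ : 1 / 2 < β) (hβ' : β ≤ 1) (hα : 1 < α)
    (hα' : α < 2 * Real.sqrt β) (hν : 1 / 2 < ν) (hν' : ν < 1) :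
    (∀ (d m : ℕ) (P : LevelSet.Problem d m), P.Admissible → ∀ ε : ℝ, 0 < ε →
      ∀ s : LevelSet.SecantState d, LevelSet.Reachable P α β ν ε s →
        -- the method never gets stuck
        (¬ s.Halted ε → ∃ s', LevelSet.SecantStep P α β ν ε s s') ∧
        -- the levels increase and stay below the optimal level
        (∀ t < s.t, s.η t < s.η (t + 1)) ∧
        (∀ t ≤ s.t, s.η t ≤ P.etaStar) ∧
        -- the initial lower bounds are valid
        (∀ t, 1 ≤ t → t ≤ s.t →
          0 ≤ s.lTilde t ∧ (β < 1 → 0 < s.lTilde t) ∧ s.lTilde t ≤ P.V (s.η t)) ∧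
        -- the output
        (s.Halted ε →
          (∀ r : ℝ, P.IsSubgradientV P.etaStar r → r < 0 →
            P.etaStar - s.η s.t ≤ ε / (-r)) ∧
          P.EpsOptimal ε (s.x s.t))) ∧
    -- the oracle complexity of the while loop
    (∀ ρ : ℝ, 0 ≤ ρ → ρ ≤ 1 → ∀ Mbar D Δ : ℝ, ∃ C : ℝ, 0 < C ∧
      ∀ (d m : ℕ) (P : LevelSet.Problem d m), P.Admissible → P.HolderSmooth ρ Mbar →
        Metric.diam P.X ≤ D → P.fStar - P.fBar ≤ Δ →
      ∀ y : Fin m → ℝ, P.IsMultiplier y → ∀ ε : ℝ, 0 < ε → ε ≤ 1 / 2 →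
      ∀ s : LevelSet.SecantState d, LevelSet.Reachable P α β ν ε s →
        (s.calls : ℝ) ≤ C * min (((∑ i, |y i|) + 1) * (Real.log ((∑ i, |y i|) + 1) + 1))
          (Real.log (1 / ε)) * (1 / ε) ^ (2 / (1 + 3 * ρ))) := by
  have hβ0 : 0 < β := by linarith
  refine ⟨fun d m P hP ε hε s hs => ?_, fun ρ hρ hρ' Mbar D Δ => ?_⟩
  · have hv := hs.valid hP hα hε hβ0
    exact ⟨hv.exists_step hP hν, fun t ht => hv.trace.lt_next hα hε hβ0 ht,
      hv.le_etaStar hP hα hε hβ0 hβ', fun t ht ht' => hv.lTilde hP hα hε hβ0 hβ' ht ht',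
      hv.halted hP hα hε hβ0 hβ'⟩
  have hq : α ^ 2 / (4 * β) < 1 := by
    rw [div_lt_one (by positivity)]
    have h1 := Real.sq_sqrt hβ0.le
    have h2 := Real.sqrt_nonneg β
    nlinarith
  -- The given constants may be negative or zero; the maxima restore the signs and ensure `ε ≤ Δ'`.
  obtain ⟨C, hC, h⟩ := LevelSet.exists_calls_le hα hβ0 hβ' hq hν hν' hρ hρ'
    (le_max_right Mbar 0) (lt_max_of_lt_right one_pos : 0 < max D 1) (le_max_right Δ 1)
  have hΔ1 : 1 ≤ max Δ 1 := le_max_right _ _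
  set Δ' := max Δ 1
  have hlog2 : 0 < Real.log 2 := Real.log_pos (by norm_num)
  have hlogα : 0 ≤ Real.log (α * Δ') := Real.log_nonneg (by nlinarith)
  -- As `log (1/ε) ≥ log 2`, the additive constant `1 + log (α Δ')` is a multiple of `log (1/ε)`.
  refine ⟨C * ((1 + Real.log (α * Δ')) / Real.log 2 + 1), by positivity,
    fun d m P hP hM hD hΔ y hy ε hε hε' s hs => ?_⟩
  have hv := hs.valid hP hα hε hβ0
  have key := h d m P hP (hM.mono (le_max_left _ _)) (hD.trans (le_max_left _ _))
    (hΔ.trans (le_max_left _ _)) ε hε hε' s hs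
  have hY : 0 ≤ ∑ i, |y i| := Finset.sum_nonneg fun i _ => abs_nonneg _
  set Y := ∑ i, |y i|
  have hlogY : 0 ≤ Real.log (Y + 1) := Real.log_nonneg (by linarith)
  have hE : 0 ≤ (1 / ε) ^ (2 / (1 + 3 * ρ)) := by positivity
  have hC2 : 1 ≤ (1 + Real.log (α * Δ')) / Real.log 2 + 1 := by
    linarith [div_nonneg (add_nonneg zero_le_one hlogα) hlog2.le]
  rw [mul_min_of_nonneg _ _ (by positivity), min_mul_of_nonneg _ _ hE]
  refine le_min ?_ ?_
  -- Multipliers supply the growth. The resulting bound is `1 + log (Y + 1)`; the factor `Y + 1 ≥ 1`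
  -- is slack.
  · refine (key (1 / (Y + 1)) (by positivity) (div_le_one_of_le₀ (by linarith) (by linarith))
      fun t _ => ?_).trans ?_
    · rw [one_div_mul_eq_div, div_le_iff₀' (by positivity)]
      exact hP.etaStar_sub_le_of_isMultiplier hy _
    · refine mul_le_mul_of_nonneg_right ?_ hE
      rw [one_div_one_div, mul_assoc C]
      refine mul_le_mul_of_nonneg_left ?_ hC.le
      refine le_trans ?_ (le_mul_of_one_le_left (by positivity) hC2)
      rw [add_comm]
      exact le_mul_of_one_le_left (by positivity) (by linarith)
  -- Growth without multipliers: a level left behind has `V ≥ l ≥ ε / α` and lies within `Δ'` of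
  -- `η*`.
  · have hκ : 0 < ε / (α * Δ') := by positivity
    refine (key (ε / (α * Δ')) hκ (div_le_one_of_le₀ (by nlinarith) (by positivity))
      fun t ht => ?_).trans ?_
    · have h1 := (hv.V_le hP hα hε hβ0 hβ' ht.le).1
      have h2 := hv.trace.eps_le ht
      have h3 := hv.trace.l_le t ht
      have h4 : P.etaStar - s.η t ≤ Δ' := h1.trans (hΔ.trans (le_max_left _ _))
      calc ε / (α * Δ') * (P.etaStar - s.η t) ≤ ε / (α * Δ') * Δ' := by gcongr
        _ = ε / α := by field_simp
        _ ≤ P.V (s.η t) := by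
          rw [div_le_iff₀' (by linarith)]
          nlinarith
    · refine mul_le_mul_of_nonneg_right ?_ hE
      rw [mul_assoc C]
      refine mul_le_mul_of_nonneg_left ?_ hC.le
      have h1 : Real.log 2 ≤ Real.log (1 / ε) :=
        Real.log_le_log (by norm_num) (by rw [le_div_iff₀ hε]; linarith)
      have h2 : Real.log (1 / (ε / (α * Δ'))) = Real.log (α * Δ') + Real.log (1 / ε) := by
        rw [← Real.log_mul (by positivity) (by positivity)]
        congr 1
        field_simp
      rw [h2, add_mul, one_mul, ← add_assoc]
      gcongr
      rw [div_mul_eq_mul_div, le_div_iff₀ hlog2]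
      gcongr
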